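/- Let $N\ge 2$ be an integer and let $q\in\mathbb{R}$ satisfy $1<q\le 2$ if $N=2$ and $1<q<N$ if $N\ge 3$. Let $\alpha,\beta,\gamma\in\mathbb{R}$ be such that $\alpha<0<\beta$, $N+\gamma>0$ and $N+\gamma+\alpha\beta<0$. Then the weight $|x|^\gamma(1+|x|^\beta)^\alpha$ is integrable on $\mathbb{R}^N$ with positive integral, and there exists a finite constant $C=C(N,\alpha,\beta,\gamma,q)>0$ such that for every compactly supported $\varphi\in W^{1,\infty}(\mathbb{R}^N)$ both of the following integrals are finite and $$\int_{\mathbb{R}^N}|\varphi-\overline{\varphi}|^q\,|x|^\gamma(1+|x|^\beta)^\alpha\,dx\le C\int_{\mathbb{R}^N}|\nabla\varphi|^q\,|x|^{\gamma+q}(1+|x|^\beta)^\alpha\,dx,$$ where $\nabla\varphi$ is the weak gradient of $\varphi$ and $$\overline{\varphi}=\frac{\int_{\mathbb{R}^N}\varphi(x)\,|x|^\gamma(1+|x|^\beta)^\alpha\,dx}{\int_{\mathbb{R}^N}|x|^\gamma(1+|x|^\beta)^\alpha\,dx}$$ is the average of $\varphi$ with respect to $|x|^\gamma(1+|x|^\beta)^\alpha\,dx$.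 -/

import Mathlib

open MeasureTheory

open scoped ENNReal ContDiff

/-- `G` is the weak (distributional) gradient of `φ` on `ℝᴺ`: both are locally integrable, and
`∫ φ ∂ᵢψ = -∫ Gᵢ ψ` for every test function `ψ ∈ C_c^∞(ℝᴺ)` and every coordinate `i`. -/
structure IsWeakGradient {N : ℕ} (φ : EuclideanSpace ℝ (Fin N) → ℝ)
    (G : EuclideanSpace ℝ (Fin N) → EuclideanSpace ℝ (Fin N)) : Prop where
  locallyIntegrable : LocallyIntegrable φ volume
  locallyIntegrable_grad : LocallyIntegrable G volume
  integral_eq : ∀ ψ : EuclideanSpace ℝ (Fin N) → ℝ, ContDiff ℝ ∞ ψ → HasCompactSupport ψ →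
    ∀ i : Fin N, ∫ x, φ x * fderiv ℝ ψ x (EuclideanSpace.single i 1) = -∫ x, G x i * ψ x

/-- `φ` belongs to the Sobolev space `W^{1,∞}(ℝᴺ)`, and `G` is its weak gradient. -/
structure IsSobolevW1InftyWithGrad {N : ℕ} (φ : EuclideanSpace ℝ (Fin N) → ℝ)
    (G : EuclideanSpace ℝ (Fin N) → EuclideanSpace ℝ (Fin N)) : Prop where
  memLp : MemLp φ ∞ volume
  memLp_grad : MemLp G ∞ volume
  isWeakGradient : IsWeakGradient φ G

/-- `φ`, as an almost-everywhere class, is compactly supported. -/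
def IsAECompactlySupported {N : ℕ} (φ : EuclideanSpace ℝ (Fin N) → ℝ) : Prop :=
  ∃ K : Set (EuclideanSpace ℝ (Fin N)), IsCompact K ∧ ∀ᵐ x ∂volume, x ∉ K → φ x = 0

/-- The weight `|x|^γ (1 + |x|^β)^α` on `ℝᴺ`. -/
noncomputable def hpWeight (N : ℕ) (α β γ : ℝ) (x : EuclideanSpace ℝ (Fin N)) : ℝ :=
  ‖x‖ ^ γ * (1 + ‖x‖ ^ β) ^ α

/-- The average `∫ φ w dx / ∫ w dx` of `φ` with respect to the measure `w(x) dx`. -/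
noncomputable def weightedAverage {N : ℕ} (w φ : EuclideanSpace ℝ (Fin N) → ℝ) : ℝ :=
  (∫ x, φ x * w x) / ∫ x, w x

/-!
The weight `w x = ‖x‖ ^ γ * (1 + ‖x‖ ^ β) ^ α` behaves like a power at the origin and like another
power at infinity, and the logarithmic derivative `p` of `m r = r ^ N * w r`
(`radialSlope`, with `r * m' = p * m`) runs from `N + γ > 0` at `0` down to `N + γ + α * β < 0` at
`∞`. The argument combines a Hardy inequality near `0` and `∞` with a Poincaré inequality on an
annulus between them.

For the Hardy part, integrate by parts against the vector field `x * p ‖x‖ * w x`, whose divergence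
is `(p ^ 2 + r * p') * w`. Since `p` has nonzero limits at `0` and `∞`, this divergence is at least
`δ * w` off a compact annulus (`exists_radialDensity_lower_bound`). The boundary terms vanish
because `m` tends to `0` at both ends, so `integral_radialDensity_add_fderiv`, applied to
`F = |φ - c| ^ q`, and Young's inequality bound `∫ |φ - c| ^ q * w` by the same integral over the
annulus plus the energy, for every constant `c`
(`exists_integral_le_annulus_add_gradEnergy`).

On the annulus both weights are comparable to constants. For `N ≥ 2` the annulus is covered by
finitely many convex caps of a ball which stay away from the origin and overlap enough to be
chained together. Each cap satisfies a Poincaré inequality by integration along segments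
(`Convex.isPoincareSet`), and these are glued by `IsPoincareSet.union`. This chooses the constant
`c`; Jensen's inequality (`abs_average_sub_rpow_mul_le`) replaces it by the weighted average.

This proves the inequality for compactly supported `C¹` functions. In general, mollify: the gradient
of a mollification is the mollification of the weak gradient, all functions involved are uniformly
bounded and supported in one ball, and dominated convergence gives both the integrability of the
energy density and the inequality in the limit.
-/

open Filter Set Topology

/-! ### The radial weight on the half-line -/

/-- The one-dimensional weight `r ^ s * (1 + r ^ β) ^ α`. With `s = N + γ` it is `r` times the
density of `hpWeight N α β γ` in polar coordinates. -/
noncomputable def radialWeight (s α β r : ℝ) : ℝ := r ^ s * (1 + r ^ β) ^ α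

/-- The logarithmic derivative `r * m' r / m r` of `m = radialWeight s α β`. It decreases from
`s` at `0` to `s + α * β` at `∞`. -/
noncomputable def radialSlope (s α β r : ℝ) : ℝ := s + α * β * (r ^ β / (1 + r ^ β))

/-- With `m = radialWeight s α β` and `p = radialSlope s α β`, this is `p ^ 2 + r * p'`, the factor
for which `(m * p)' = (m / r) * (p ^ 2 + r * p')`. -/
noncomputable def radialDensity (s α β r : ℝ) : ℝ :=
  radialSlope s α β r ^ 2 + α * β ^ 2 * (r ^ β / (1 + r ^ β) * (1 - r ^ β / (1 + r ^ β)))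

theorem rpow_ratio_mem {β r : ℝ} (hr : 0 ≤ r) :
    0 ≤ r ^ β / (1 + r ^ β) ∧ r ^ β / (1 + r ^ β) ≤ 1 := by
  have h : 0 ≤ r ^ β := Real.rpow_nonneg hr β
  exact ⟨by positivity, by rw [div_le_one (by positivity)]; linarith⟩

theorem tendsto_rpow_ratio_zero {β : ℝ} (hβ : 0 < β) :
    Tendsto (fun r : ℝ => r ^ β / (1 + r ^ β)) (𝓝 0) (𝓝 0) := by
  have h : Tendsto (fun r : ℝ => r ^ β) (𝓝 0) (𝓝 0) := by
    simpa [Real.zero_rpow hβ.ne'] using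
      (Real.continuousAt_rpow_const 0 β (Or.inr hβ.le)).tendsto
  have h1 := h.div (h.const_add 1) (by norm_num)
  rw [zero_div] at h1
  exact h1

theorem tendsto_rpow_ratio_atTop {β : ℝ} (hβ : 0 < β) :
    Tendsto (fun r : ℝ => r ^ β / (1 + r ^ β)) atTop (𝓝 1) := by
  have h : Tendsto (fun r : ℝ => (1 + r ^ β)⁻¹) atTop (𝓝 0) :=
    tendsto_inv_atTop_zero.comp (tendsto_atTop_add_const_left _ 1 (tendsto_rpow_atTop hβ))
  have h1 := h.const_sub 1
  rw [sub_zero] at h1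
  refine h1.congr' ?_
  filter_upwards [eventually_ge_atTop 0] with r hr
  have : 0 ≤ r ^ β := Real.rpow_nonneg hr β
  field_simp
  ring

theorem radialWeight_nonneg (s α β : ℝ) {r : ℝ} (hr : 0 ≤ r) : 0 ≤ radialWeight s α β r := by
  have : 0 ≤ r ^ β := Real.rpow_nonneg hr β
  unfold radialWeight
  positivity

theorem radialWeight_le_rpow {s α β r : ℝ} (hα : α < 0) (hr : 0 ≤ r) :
    radialWeight s α β r ≤ r ^ s := by
  have h : 0 ≤ r ^ β := Real.rpow_nonneg hr β
  exact mul_le_of_le_one_right (Real.rpow_nonneg hr s)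
    (Real.rpow_le_one_of_one_le_of_nonpos (by linarith) hα.le)

theorem radialWeight_le_rpow_add {s α β r : ℝ} (hα : α < 0) (hr : 0 < r) :
    radialWeight s α β r ≤ r ^ (s + α * β) := by
  have h : 0 < r ^ β := Real.rpow_pos_of_pos hr β
  rw [Real.rpow_add hr, mul_comm α β, Real.rpow_mul hr.le]
  exact mul_le_mul_of_nonneg_left
    (Real.rpow_le_rpow_of_nonpos h (by linarith) hα.le) (Real.rpow_nonneg hr.le s)

theorem radialWeight_zero {s α β : ℝ} (hs : 0 < s) : radialWeight s α β 0 = 0 := by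
  simp [radialWeight, Real.zero_rpow hs.ne']

theorem tendsto_radialWeight_zero {s α β : ℝ} (hs : 0 < s) (hα : α < 0) :
    Tendsto (radialWeight s α β) (𝓝[≥] 0) (𝓝 0) := by
  have h : Tendsto (fun r : ℝ => r ^ s) (𝓝[≥] 0) (𝓝 0) := by
    simpa [Real.zero_rpow hs.ne'] using
      (Real.continuousAt_rpow_const 0 s (Or.inr hs.le)).tendsto.mono_left nhdsWithin_le_nhds
  refine squeeze_zero' ?_ ?_ h <;> filter_upwards [self_mem_nhdsWithin] with r hr
  · exact radialWeight_nonneg _ _ _ hr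
  · exact radialWeight_le_rpow hα hr

theorem tendsto_radialWeight_atTop {s α β : ℝ} (hα : α < 0) (hsum : s + α * β < 0) :
    Tendsto (radialWeight s α β) atTop (𝓝 0) := by
  have h : Tendsto (fun r : ℝ => r ^ (s + α * β)) atTop (𝓝 0) := by
    simpa using tendsto_rpow_neg_atTop (neg_pos.2 hsum)
  refine squeeze_zero' ?_ ?_ h <;> filter_upwards [eventually_gt_atTop 0] with r hr
  · exact radialWeight_nonneg _ _ _ hr.le
  · exact radialWeight_le_rpow_add hα hr

theorem continuousOn_radialWeight (s α β : ℝ) : ContinuousOn (radialWeight s α β) (Ioi 0) := by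
  intro r (hr : 0 < r)
  have h : 0 < r ^ β := Real.rpow_pos_of_pos hr β
  have h1 : ContinuousAt (fun r : ℝ => 1 + r ^ β) r :=
    continuousAt_const.add (Real.continuousAt_rpow_const r β (Or.inl hr.ne'))
  exact ((Real.continuousAt_rpow_const r s (Or.inl hr.ne')).mul
    (h1.rpow_const (Or.inl (by positivity)))).continuousWithinAt

theorem integrableOn_radialWeight_div {s α β : ℝ} (hs : 0 < s) (hα : α < 0)
    (hsum : s + α * β < 0) : IntegrableOn (fun r => radialWeight s α β r / r) (Ioi 0) := by
  have hc : ContinuousOn (fun r => radialWeight s α β r / r) (Ioi 0) :=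
    (continuousOn_radialWeight s α β).div continuousOn_id fun r hr => ne_of_gt hr
  rw [← Ioc_union_Ioi_eq_Ioi zero_le_one]
  refine IntegrableOn.union ?_ ?_
  · have h := (intervalIntegral.intervalIntegrable_rpow' (a := 0) (b := 1)
      (r := s - 1) (by linarith)).1
    refine h.mono' ((hc.mono Ioc_subset_Ioi_self).aestronglyMeasurable measurableSet_Ioc) ?_
    filter_upwards [ae_restrict_mem measurableSet_Ioc] with r hr
    rw [Real.norm_of_nonneg (div_nonneg (radialWeight_nonneg _ _ _ hr.1.le) hr.1.le),
      Real.rpow_sub_one hr.1.ne']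
    exact div_le_div_of_nonneg_right (radialWeight_le_rpow hα hr.1.le) hr.1.le
  · have h := integrableOn_Ioi_rpow_of_lt (a := s + α * β - 1) (c := 1) (by linarith) zero_lt_one
    refine h.mono' ((hc.mono (Ioi_subset_Ioi zero_le_one)).aestronglyMeasurable
      measurableSet_Ioi) ?_
    filter_upwards [ae_restrict_mem measurableSet_Ioi] with r hr
    have hr : 0 < r := zero_lt_one.trans hr
    rw [Real.norm_of_nonneg (div_nonneg (radialWeight_nonneg _ _ _ hr.le) hr.le),
      Real.rpow_sub_one hr.ne']
    exact div_le_div_of_nonneg_right (radialWeight_le_rpow_add hα hr) hr.le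

theorem hasDerivAt_radialWeight {s α β r : ℝ} (hr : 0 < r) :
    HasDerivAt (radialWeight s α β) (radialWeight s α β r / r * radialSlope s α β r) r := by
  have h : 0 < r ^ β := Real.rpow_pos_of_pos hr β
  have h1 := Real.hasDerivAt_rpow_const (x := r) (p := s) (Or.inl hr.ne')
  have h2 := ((Real.hasDerivAt_rpow_const (x := r) (p := β) (Or.inl hr.ne')).const_add 1).rpow_const
    (p := α) (Or.inl (by positivity))
  refine (h1.mul h2).congr_deriv ?_
  unfold radialWeight radialSlope
  rw [Real.rpow_sub_one hr.ne', Real.rpow_sub_one hr.ne', Real.rpow_sub_one (by positivity)]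
  field_simp

theorem hasDerivAt_radialSlope {s α β r : ℝ} (hr : 0 < r) :
    HasDerivAt (radialSlope s α β)
      (α * β ^ 2 * (r ^ β / (1 + r ^ β) * (1 - r ^ β / (1 + r ^ β))) / r) r := by
  have h : 0 < r ^ β := Real.rpow_pos_of_pos hr β
  have h1 := Real.hasDerivAt_rpow_const (x := r) (p := β) (Or.inl hr.ne')
  refine (((h1.div (h1.const_add 1) (by positivity)).const_mul (α * β)).const_add s).congr_deriv ?_
  rw [Real.rpow_sub_one hr.ne']
  field_simp

theorem hasDerivAt_radialWeight_mul_radialSlope {s α β r : ℝ} (hr : 0 < r) :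
    HasDerivAt (fun r => radialWeight s α β r * radialSlope s α β r)
      (radialWeight s α β r / r * radialDensity s α β r) r := by
  refine ((hasDerivAt_radialWeight hr).mul (hasDerivAt_radialSlope hr)).congr_deriv ?_
  unfold radialDensity
  field_simp

theorem abs_radialSlope_le {s α β r : ℝ} (hr : 0 ≤ r) :
    |radialSlope s α β r| ≤ |s| + |α * β| := by
  obtain ⟨h0, h1⟩ := rpow_ratio_mem (β := β) hr
  refine (abs_add_le _ _).trans (add_le_add le_rfl ?_)
  rw [abs_mul, abs_of_nonneg h0]
  exact mul_le_of_le_one_right (abs_nonneg _) h1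

theorem abs_radialDensity_le {s α β r : ℝ} (hr : 0 ≤ r) :
    |radialDensity s α β r| ≤ (|s| + |α * β|) ^ 2 + |α * β ^ 2| := by
  obtain ⟨h0, h1⟩ := rpow_ratio_mem (β := β) hr
  refine (abs_add_le _ _).trans (add_le_add ?_ ?_)
  · rw [abs_pow]
    exact pow_le_pow_left₀ (abs_nonneg _) (abs_radialSlope_le hr) 2
  · rw [abs_mul, abs_of_nonneg (mul_nonneg h0 (sub_nonneg.2 h1))]
    exact mul_le_of_le_one_right (abs_nonneg _) (by nlinarith)

/-- Since the slope tends to the nonzero numbers `s` at `0` and `s + α * β` at `∞`, the density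
`radialDensity` is bounded below by a positive constant away from a compact part of `(0, ∞)`. -/
theorem exists_radialDensity_lower_bound {s α β : ℝ} (hs : 0 < s) (hβ : 0 < β)
    (hsum : s + α * β < 0) :
    ∃ δ a b B : ℝ, 0 < δ ∧ 0 < a ∧ a < b ∧ 0 < B ∧
      ∀ r, 0 < r → δ ≤ radialDensity s α β r + B * (Icc a b).indicator 1 r := by
  have key : ∀ (l : Filter ℝ) (t : ℝ), Tendsto (fun r : ℝ => r ^ β / (1 + r ^ β)) l (𝓝 t) →
      Tendsto (radialDensity s α β) l (𝓝 ((s + α * β * t) ^ 2 + α * β ^ 2 * (t * (1 - t)))) := by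
    intro l t h
    exact (((h.const_mul (α * β)).const_add s).pow 2).add
      ((h.mul (h.const_sub 1)).const_mul (α * β ^ 2))
  have h0 := key _ _ (tendsto_rpow_ratio_zero hβ)
  have h1 := key _ _ (tendsto_rpow_ratio_atTop hβ)
  simp only [mul_zero, add_zero, zero_mul, mul_one, sub_self] at h0 h1
  have hp0 : 0 < s ^ 2 := by positivity
  have hp1 : 0 < (s + α * β) ^ 2 := by nlinarith
  set δ := min (s ^ 2) ((s + α * β) ^ 2) / 2 with hδ
  have hδ0 : 0 < δ := by rw [hδ]; positivity
  have e0 : δ < s ^ 2 := (half_lt_self (by positivity)).trans_le (min_le_left _ _)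
  have e1 : δ < (s + α * β) ^ 2 := (half_lt_self (by positivity)).trans_le (min_le_right _ _)
  obtain ⟨a, ha, haδ⟩ := Metric.eventually_nhds_iff.1 (h0.eventually_const_le e0)
  obtain ⟨b, hbδ⟩ := eventually_atTop.1 (h1.eventually_const_le e1)
  have hB : 0 ≤ (|s| + |α * β|) ^ 2 + |α * β ^ 2| := by positivity
  refine ⟨δ, a, max b (a + 1), δ + ((|s| + |α * β|) ^ 2 + |α * β ^ 2|), hδ0, ha,
    (lt_add_one a).trans_le (le_max_right _ _), by linarith, fun r hr => ?_⟩
  by_cases hm : r ∈ Icc a (max b (a + 1))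
  · have := neg_le_of_abs_le (abs_radialDensity_le (s := s) (α := α) (β := β) hr.le)
    simp only [hm, indicator_of_mem, Pi.one_apply]
    linarith
  · simp only [hm, not_false_eq_true, indicator_of_notMem, mul_zero, add_zero]
    rw [mem_Icc, not_and_or, not_le, not_le] at hm
    rcases hm with hm | hm
    · exact haδ (by rwa [Real.dist_eq, sub_zero, abs_of_pos hr])
    · exact hbδ r ((le_max_left _ _).trans hm.le)

/-! ### Integration along rays -/

theorem integral_eq_zero_of_forall_ray {E : Type*} [NormedAddCommGroup E] [NormedSpace ℝ E]
    [MeasurableSpace E] [BorelSpace E] [FiniteDimensional ℝ E] [Nontrivial E] (μ : Measure E)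
    [μ.IsAddHaarMeasure] (F : E → ℝ)
    (h : ∀ ζ : E, ‖ζ‖ = 1 →
      ∫ r in Ioi (0 : ℝ), r ^ (Module.finrank ℝ E - 1) * F (r • ζ) = 0) :
    ∫ x, F x ∂μ = 0 := by
  by_cases hF : Integrable F μ
  swap
  · exact integral_undef hF
  have hmp := μ.measurePreserving_homeomorphUnitSphereProd
  have hemb := (homeomorphUnitSphereProd E).measurableEmbedding
  set g : Metric.sphere (0 : E) 1 × Ioi (0 : ℝ) → ℝ := fun z => F (z.2.1 • z.1.1) with hg
  have hcomp : ∀ x : ({0}ᶜ : Set E), g (homeomorphUnitSphereProd E x) = F x := by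
    intro x
    have hx : ‖(x : E)‖ ≠ 0 := norm_ne_zero_iff.2 x.2
    simp [hg, homeomorphUnitSphereProd, smul_smul, hx]
  have hgi : Integrable g (μ.toSphere.prod (.volumeIoiPow (Module.finrank ℝ E - 1))) := by
    rw [← hmp.integrable_comp_emb hemb]
    have : (g ∘ homeomorphUnitSphereProd E) = F ∘ (Subtype.val : ({0}ᶜ : Set E) → E) := by
      funext x
      exact hcomp x
    rw [this, ← integrableOn_iff_comap_subtypeVal (measurableSet_singleton 0).compl]
    exact hF.integrableOn
  calc ∫ x, F x ∂μ = ∫ x in ({0}ᶜ : Set E), F x ∂μ := by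
        rw [restrict_compl_singleton]
    _ = ∫ x : ({0}ᶜ : Set E), g (homeomorphUnitSphereProd E x) ∂(μ.comap (↑)) := by
        rw [← integral_subtype_comap (measurableSet_singleton 0).compl]
        simp only [hcomp]
    _ = ∫ z, g z ∂(μ.toSphere.prod (.volumeIoiPow (Module.finrank ℝ E - 1))) :=
        hmp.integral_comp hemb g
    _ = 0 := by
        rw [integral_prod _ hgi]
        refine integral_eq_zero_of_ae (Eventually.of_forall fun ζ => ?_)
        have hζ : ‖(ζ : E)‖ = 1 := by simp
        refine Eq.trans ?_ (h ζ hζ)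
        simp only [Measure.volumeIoiPow, ENNReal.ofReal, hg]
        rw [integral_withDensity_eq_integral_smul,
          integral_subtype_comap measurableSet_Ioi
            fun a : ℝ => Real.toNNReal (a ^ (Module.finrank ℝ E - 1)) • F (a • (ζ : E)),
          setIntegral_congr_fun measurableSet_Ioi fun x hx => ?_]
        · rw [NNReal.smul_def, Real.coe_toNNReal _ (pow_nonneg (le_of_lt hx) _), smul_eq_mul]
        · exact (measurable_subtype_coe.pow_const _).real_toNNReal

section Ray

variable {N : ℕ} {q α β γ : ℝ}

theorem pow_mul_hpWeight_eq (hN : 1 ≤ N) {r : ℝ} (hr : 0 < r) :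
    r ^ (N - 1) * (r ^ γ * (1 + r ^ β) ^ α) = radialWeight (N + γ) α β r / r := by
  obtain ⟨n, rfl⟩ := Nat.exists_eq_add_of_le hN
  unfold radialWeight
  rw [Real.rpow_add hr, Real.rpow_natCast, Nat.add_sub_cancel_left, pow_add]
  field_simp

theorem measurable_hpWeight : Measurable (hpWeight N α β γ) := by
  unfold hpWeight
  fun_prop

theorem hpWeight_nonneg (x : EuclideanSpace ℝ (Fin N)) : 0 ≤ hpWeight N α β γ x := by
  unfold hpWeight
  have : 0 ≤ ‖x‖ ^ β := by positivity
  positivity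

theorem integrable_hpWeight (hN : 1 ≤ N) (hα : α < 0) (hγ : 0 < N + γ)
    (hαβγ : N + γ + α * β < 0) : Integrable (hpWeight N α β γ) := by
  have : Nonempty (Fin N) := ⟨⟨0, hN⟩⟩
  refine (integrable_fun_norm_addHaar volume
    (f := fun r : ℝ => r ^ γ * (1 + r ^ β) ^ α)).2 ?_
  rw [finrank_euclideanSpace_fin]
  refine (integrableOn_radialWeight_div hγ hα hαβγ).congr_fun ?_ measurableSet_Ioi
  intro r hr
  exact (pow_mul_hpWeight_eq hN hr).symm

theorem hpWeight_pos {x : EuclideanSpace ℝ (Fin N)} (hx : x ≠ 0) : 0 < hpWeight N α β γ x := by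
  unfold hpWeight
  have : 0 < ‖x‖ := norm_pos_iff.2 hx
  positivity

theorem integral_hpWeight_pos (hN : 1 ≤ N) (hα : α < 0) (hγ : 0 < N + γ)
    (hαβγ : N + γ + α * β < 0) : 0 < ∫ x, hpWeight N α β γ x := by
  have : Nonempty (Fin N) := ⟨⟨0, hN⟩⟩
  rw [integral_pos_iff_support_of_nonneg hpWeight_nonneg (integrable_hpWeight hN hα hγ hαβγ)]
  have h : ({0}ᶜ : Set (EuclideanSpace ℝ (Fin N))) ⊆ Function.support (hpWeight N α β γ) :=
    fun x hx => (hpWeight_pos hx).ne'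
  refine lt_of_lt_of_le ?_ (measure_mono h)
  exact isOpen_compl_singleton.measure_pos volume
    (exists_ne (0 : EuclideanSpace ℝ (Fin N)))

/-- The factor `‖x‖` in the energy weight is absorbed into the gradient. -/
theorem energyWeight_eq {x : EuclideanSpace ℝ (Fin N)} (hx : x ≠ 0) :
    ‖x‖ ^ (γ + q) * (1 + ‖x‖ ^ β) ^ α = ‖x‖ ^ q * hpWeight N α β γ x := by
  rw [hpWeight, Real.rpow_add (norm_pos_iff.2 hx)]
  ring

/-- Integration by parts against the vector field `x * p ‖x‖ * w x`, where `w` is the weight and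
`p` the logarithmic derivative of its radial profile. -/
theorem integral_radialDensity_add_fderiv (hN : 1 ≤ N) (hα : α < 0)
    (hγ : 0 < N + γ) (hαβγ : N + γ + α * β < 0) {F : EuclideanSpace ℝ (Fin N) → ℝ}
    (hF : ContDiff ℝ 1 F) {M D : ℝ} (hM : ∀ x, |F x| ≤ M) (hD : ∀ x, |fderiv ℝ F x x| ≤ D) :
    ∫ x, (F x * radialDensity (N + γ) α β ‖x‖ + fderiv ℝ F x x * radialSlope (N + γ) α β ‖x‖)
      * hpWeight N α β γ x = 0 := by
  have : Nonempty (Fin N) := ⟨⟨0, hN⟩⟩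
  refine integral_eq_zero_of_forall_ray volume _ fun ζ hζ => ?_
  rw [finrank_euclideanSpace_fin]
  set s : ℝ := N + γ
  have hdF : Continuous (fderiv ℝ F) := hF.continuous_fderiv one_ne_zero
  set H : ℝ → ℝ := fun r => F (r • ζ) * (radialWeight s α β r * radialSlope s α β r) with hH
  set H' : ℝ → ℝ := fun r => (F (r • ζ) * radialDensity s α β r +
    fderiv ℝ F (r • ζ) (r • ζ) * radialSlope s α β r) * (radialWeight s α β r / r) with hH'
  have hcongr : ∀ r ∈ Ioi (0 : ℝ), r ^ (N - 1) * ((F (r • ζ) * radialDensity s α β ‖r • ζ‖ +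
      fderiv ℝ F (r • ζ) (r • ζ) * radialSlope s α β ‖r • ζ‖) * hpWeight N α β γ (r • ζ))
      = H' r := by
    intro r hr
    have hn : ‖r • ζ‖ = r := by rw [norm_smul, hζ, mul_one, Real.norm_of_nonneg (le_of_lt hr)]
    rw [hpWeight, hn, hH']
    simp only [s]
    rw [← pow_mul_hpWeight_eq hN hr]
    ring
  rw [setIntegral_congr_fun measurableSet_Ioi hcongr]
  have hbound : ∀ r, 0 ≤ r → |F (r • ζ) * radialDensity s α β r +
      fderiv ℝ F (r • ζ) (r • ζ) * radialSlope s α β r| ≤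
      M * ((|s| + |α * β|) ^ 2 + |α * β ^ 2|) + D * (|s| + |α * β|) := by
    intro r hr
    refine (abs_add_le _ _).trans (add_le_add ?_ ?_) <;> rw [abs_mul]
    · exact mul_le_mul (hM _) (abs_radialDensity_le hr) (abs_nonneg _)
        ((abs_nonneg _).trans (hM 0))
    · exact mul_le_mul (hD _) (abs_radialSlope_le hr) (abs_nonneg _)
        ((abs_nonneg _).trans (hD 0))
  have hint : IntegrableOn H' (Ioi 0) := by
    refine Integrable.bdd_mul (integrableOn_radialWeight_div hγ hα hαβγ)
      (c := M * ((|s| + |α * β|) ^ 2 + |α * β ^ 2|) + D * (|s| + |α * β|)) ?_ ?_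
    · refine Measurable.aestronglyMeasurable ?_
      have h1 : Continuous fun r : ℝ => F (r • ζ) := hF.continuous.comp (by fun_prop)
      have h2 : Continuous fun r : ℝ => fderiv ℝ F (r • ζ) (r • ζ) :=
        (hdF.comp (by fun_prop : Continuous fun r : ℝ => r • ζ)).clm_apply (by fun_prop)
      have h3 : Measurable (radialDensity s α β) := by
        unfold radialDensity radialSlope
        fun_prop
      have h4 : Measurable (radialSlope s α β) := by
        unfold radialSlope
        fun_prop
      exact (h1.measurable.mul h3).add (h2.measurable.mul h4)
    · filter_upwards [ae_restrict_mem measurableSet_Ioi] with r hr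
      exact hbound r (le_of_lt hr)
  have hderiv : ∀ r ∈ Ioi (0 : ℝ), HasDerivAt H (H' r) r := by
    intro r hr
    have h1 : HasDerivAt (fun r : ℝ => F (r • ζ)) (fderiv ℝ F (r • ζ) ζ) r := by
      have hl : HasDerivAt (fun r : ℝ => r • ζ) ζ r := by
        simpa using (hasDerivAt_id r).smul_const ζ
      exact ((hF.differentiable one_ne_zero (r • ζ)).hasFDerivAt).comp_hasDerivAt r hl
    refine (h1.mul (hasDerivAt_radialWeight_mul_radialSlope hr)).congr_deriv ?_
    have hr0 : r ≠ 0 := ne_of_gt hr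
    simp only [hH', map_smul, smul_eq_mul]
    field_simp
    ring
  have hHle : ∀ r, 0 ≤ r → ‖H r‖ ≤ M * (|s| + |α * β|) * radialWeight s α β r := by
    intro r hr
    have h0 := radialWeight_nonneg s α β hr
    rw [Real.norm_eq_abs, abs_mul, abs_mul, abs_of_nonneg h0]
    calc |F (r • ζ)| * (radialWeight s α β r * |radialSlope s α β r|)
        ≤ M * (radialWeight s α β r * (|s| + |α * β|)) := by
          refine mul_le_mul (hM _) (mul_le_mul_of_nonneg_left (abs_radialSlope_le hr) h0)
            (by positivity) ((abs_nonneg _).trans (hM 0))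
      _ = _ := by ring
  have hH0 : H 0 = 0 := by simp [hH, radialWeight_zero hγ]
  have hzero : ContinuousWithinAt H (Ici 0) 0 := by
    rw [ContinuousWithinAt, hH0]
    refine squeeze_zero_norm' (a := fun r => M * (|s| + |α * β|) * radialWeight s α β r) ?_ ?_
    · filter_upwards [self_mem_nhdsWithin] with r hr using hHle r hr
    · simpa using (tendsto_radialWeight_zero (β := β) hγ hα).const_mul (M * (|s| + |α * β|))
  have htop : Tendsto H atTop (𝓝 0) := by
    refine squeeze_zero_norm' (a := fun r => M * (|s| + |α * β|) * radialWeight s α β r) ?_ ?_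
    · filter_upwards [eventually_ge_atTop 0] with r hr using hHle r hr
    · simpa using (tendsto_radialWeight_atTop hα hαβγ).const_mul (M * (|s| + |α * β|))
  rw [integral_Ioi_of_hasDerivAt_of_tendsto hzero hderiv hint htop, hH0, sub_zero]

end Ray

/-! ### Reduction to an annulus -/

section Reduction

variable {N : ℕ} {q α β γ : ℝ}

theorem rpow_sub_one_mul_le {a b ε : ℝ} (hq : 1 < q) (ha : 0 ≤ a) (hb : 0 ≤ b) (hε : 0 < ε) :
    a ^ (q - 1) * b ≤ ε * a ^ q + ε ^ (1 - q) * b ^ q := by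
  have split : ∀ t : ℝ, 0 ≤ t → t ^ (q - 1) * t = t ^ q := fun t ht => by
    conv_lhs => rw [← Real.rpow_one t, ← Real.rpow_mul ht, one_mul,
      ← Real.rpow_add_of_nonneg ht (by linarith) zero_le_one, sub_add_cancel]
  rcases le_total b (ε * a) with h | h
  · calc a ^ (q - 1) * b ≤ a ^ (q - 1) * (ε * a) := by gcongr
      _ = ε * a ^ q := by rw [← split a ha]; ring
      _ ≤ _ := le_add_of_nonneg_right (by positivity)
  · have h1 : a ≤ b / ε := by rw [le_div_iff₀ hε]; linarith
    calc a ^ (q - 1) * b ≤ (b / ε) ^ (q - 1) * b := by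
          gcongr
      _ = ε ^ (1 - q) * b ^ q := by
          rw [← split b hb, Real.div_rpow hb hε.le, div_eq_mul_inv, ← Real.rpow_neg hε.le, neg_sub]
          ring
      _ ≤ _ := le_add_of_nonneg_left (by positivity)

/-- The weighted Dirichlet energy `∫ |∇φ| ^ q |x| ^ (γ + q) (1 + |x| ^ β) ^ α`. -/
noncomputable def gradEnergy (q α β γ : ℝ) (φ : EuclideanSpace ℝ (Fin N) → ℝ) : ℝ :=
  ∫ x, ‖fderiv ℝ φ x‖ ^ q * hpWeight N α β (γ + q) x

theorem gradEnergy_nonneg (φ : EuclideanSpace ℝ (Fin N) → ℝ) : 0 ≤ gradEnergy q α β γ φ :=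
  integral_nonneg fun x => mul_nonneg (by positivity) (hpWeight_nonneg x)

theorem energyWeight_ae_eq (hN : 1 ≤ N) (q α β γ : ℝ) :
    ∀ᵐ x : EuclideanSpace ℝ (Fin N), hpWeight N α β (γ + q) x = ‖x‖ ^ q * hpWeight N α β γ x := by
  have : Nonempty (Fin N) := ⟨⟨0, hN⟩⟩
  filter_upwards [compl_mem_ae_iff.2 (measure_singleton (0 : EuclideanSpace ℝ (Fin N)))] with x hx
  exact energyWeight_eq hx

theorem exists_norm_fderiv_mul_norm_le {φ : EuclideanSpace ℝ (Fin N) → ℝ} (hφ : ContDiff ℝ 1 φ)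
    (hs : HasCompactSupport φ) : ∃ D, ∀ x, ‖fderiv ℝ φ x‖ * ‖x‖ ≤ D := by
  have hc : Continuous fun x => ‖fderiv ℝ φ x‖ * ‖x‖ :=
    (hφ.continuous_fderiv one_ne_zero).norm.mul continuous_norm
  have hsupp : HasCompactSupport fun x => ‖fderiv ℝ φ x‖ * ‖x‖ := (hs.fderiv ℝ).norm.mul_right
  obtain ⟨D, hD⟩ := hc.bounded_above_of_compact_support hsupp
  exact ⟨D, fun x => (le_abs_self _).trans (hD x)⟩

theorem integrable_norm_fderiv_mul (hN : 1 ≤ N) (hq : 1 < q) (hα : α < 0) (hγ : 0 < N + γ)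
    (hαβγ : N + γ + α * β < 0) {φ : EuclideanSpace ℝ (Fin N) → ℝ} (hφ : ContDiff ℝ 1 φ)
    (hs : HasCompactSupport φ) :
    Integrable fun x => ‖fderiv ℝ φ x‖ ^ q * hpWeight N α β (γ + q) x := by
  obtain ⟨D, hD⟩ := exists_norm_fderiv_mul_norm_le hφ hs
  have hc := hφ.continuous_fderiv one_ne_zero
  have h : Integrable fun x => (‖fderiv ℝ φ x‖ * ‖x‖) ^ q * hpWeight N α β γ x := by
    refine (integrable_hpWeight hN hα hγ hαβγ).bdd_mul (c := D ^ q) ?_ ?_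
    · exact ((hc.norm.mul continuous_norm).rpow_const
        fun x => Or.inr (by linarith)).aestronglyMeasurable
    · refine Eventually.of_forall fun x => ?_
      rw [Real.norm_of_nonneg (by positivity)]
      exact Real.rpow_le_rpow (by positivity) (hD x) (by linarith)
  refine h.congr ?_
  filter_upwards [energyWeight_ae_eq hN q α β γ] with x hx
  rw [hx, Real.mul_rpow (norm_nonneg _) (norm_nonneg _), mul_assoc]

theorem integrable_abs_sub_rpow_mul (hN : 1 ≤ N) (hq : 1 < q) (hα : α < 0) (hγ : 0 < N + γ)
    (hαβγ : N + γ + α * β < 0) {φ : EuclideanSpace ℝ (Fin N) → ℝ} {M : ℝ}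
    (hφ : AEStronglyMeasurable φ) (hM : ∀ᵐ x, |φ x| ≤ M) (c : ℝ) :
    Integrable fun x => |φ x - c| ^ q * hpWeight N α β γ x := by
  refine (integrable_hpWeight hN hα hγ hαβγ).bdd_mul (c := (M + |c|) ^ q) ?_ ?_
  · exact ((hφ.sub aestronglyMeasurable_const).norm.aemeasurable.pow_const q).aestronglyMeasurable
  · filter_upwards [hM] with x hx
    rw [Real.norm_of_nonneg (by positivity)]
    exact Real.rpow_le_rpow (abs_nonneg _) ((abs_sub _ _).trans (by gcongr)) (by linarith)

/-- The weighted norm of `φ - c` is controlled by its part on an annulus and the energy. The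
constant `c` is arbitrary. -/
theorem exists_integral_le_annulus_add_gradEnergy (hN : 1 ≤ N) (hq : 1 < q) (hα : α < 0)
    (hβ : 0 < β) (hγ : 0 < N + γ) (hαβγ : N + γ + α * β < 0) :
    ∃ a b A : ℝ, 0 < a ∧ a < b ∧ 0 < A ∧ ∀ φ : EuclideanSpace ℝ (Fin N) → ℝ,
      ContDiff ℝ 1 φ → HasCompactSupport φ → ∀ c : ℝ,
      ∫ x, |φ x - c| ^ q * hpWeight N α β γ x ≤
        A * ((∫ x in {x | a ≤ ‖x‖ ∧ ‖x‖ ≤ b}, |φ x - c| ^ q * hpWeight N α β γ x)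
          + gradEnergy q α β γ φ) := by
  obtain ⟨δ, a, b, B, hδ, ha, hab, hB, hlow⟩ := exists_radialDensity_lower_bound (α := α) hγ hβ hαβγ
  set s : ℝ := N + γ with hs_def
  set P : ℝ := |s| + |α * β| + 1 with hP
  have hP0 : 0 < P := by positivity
  set ε : ℝ := δ / (2 * (q * P)) with hε
  have hε0 : 0 < ε := by positivity
  set K : ℝ := q * P * ε ^ (1 - q) with hK
  have hK0 : 0 < K := by positivity
  refine ⟨a, b, 2 / δ * (B + K), ha, hab, by positivity, fun φ hφ hs c => ?_⟩
  set w := hpWeight N α β γ with hw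
  set Ω : Set (EuclideanSpace ℝ (Fin N)) := {x | a ≤ ‖x‖ ∧ ‖x‖ ≤ b} with hΩ
  have hΩm : MeasurableSet Ω :=
    (measurableSet_le measurable_const measurable_norm).inter
      (measurableSet_le measurable_norm measurable_const)
  set F : EuclideanSpace ℝ (Fin N) → ℝ := fun x => ‖φ x - c‖ ^ q with hF
  have hFc : ContDiff ℝ 1 F := (contDiff_norm_rpow hq).comp (hφ.sub contDiff_const)
  obtain ⟨M, hM⟩ := hφ.continuous.bounded_above_of_compact_support hs
  obtain ⟨D, hD⟩ := exists_norm_fderiv_mul_norm_le hφ hs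
  have hub : ∀ x, |φ x - c| ≤ M + |c| := fun x => (abs_sub _ _).trans (by gcongr; exact hM x)
  have hFM : ∀ x, |F x| ≤ (M + |c|) ^ q := fun x => by
    rw [abs_of_nonneg (by positivity)]
    exact Real.rpow_le_rpow (abs_nonneg _) (hub x) (by linarith)
  have hFx : ∀ x, |fderiv ℝ F x x| ≤ q * (|φ x - c| ^ (q - 1) * (‖fderiv ℝ φ x‖ * ‖x‖)) := by
    intro x
    have h1 := norm_fderiv_norm_rpow_le (f := fun x => φ x - c)
      ((hφ.differentiable one_ne_zero).sub_const c) (x := x) hq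
    rw [fderiv_sub_const] at h1
    calc |fderiv ℝ F x x| ≤ ‖fderiv ℝ F x‖ * ‖x‖ := (fderiv ℝ F x).le_opNorm x
      _ ≤ q * ‖φ x - c‖ ^ (q - 1) * ‖fderiv ℝ φ x‖ * ‖x‖ := by gcongr
      _ = _ := by rw [Real.norm_eq_abs]; ring
  have hFD : ∀ x, |fderiv ℝ F x x| ≤ q * ((M + |c|) ^ (q - 1) * D) := fun x => by
    refine (hFx x).trans ?_
    have h0 : 0 ≤ M + |c| := (abs_nonneg _).trans (hub x)
    have := Real.rpow_le_rpow (abs_nonneg _) (hub x) (z := q - 1) (by linarith)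
    have := hD x
    gcongr
  have hzero := integral_radialDensity_add_fderiv hN hα hγ hαβγ hFc hFM hFD
  have iw := integrable_hpWeight hN hα hγ hαβγ
  have iu : Integrable fun x => F x * w x :=
    integrable_abs_sub_rpow_mul hN hq hα hγ hαβγ hφ.continuous.aestronglyMeasurable
      (Eventually.of_forall hM) c
  have iE := integrable_norm_fderiv_mul hN hq hα hγ hαβγ hφ hs
  have iΨ : Integrable fun x => (F x * radialDensity s α β ‖x‖ +
      fderiv ℝ F x x * radialSlope s α β ‖x‖) * w x := by
    refine iw.bdd_mul (c := (M + |c|) ^ q * ((|s| + |α * β|) ^ 2 + |α * β ^ 2|) +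
      q * ((M + |c|) ^ (q - 1) * D) * (|s| + |α * β|)) ?_ (Eventually.of_forall fun x => ?_)
    · refine Measurable.aestronglyMeasurable ?_
      have h2 : Continuous fun x => fderiv ℝ F x x :=
        (hFc.continuous_fderiv one_ne_zero).clm_apply continuous_id
      have h3 : Measurable (radialDensity s α β) := by
        unfold radialDensity radialSlope
        fun_prop
      have h4 : Measurable (radialSlope s α β) := by
        unfold radialSlope
        fun_prop
      exact (hFc.continuous.measurable.mul (h3.comp measurable_norm)).add
        (h2.measurable.mul (h4.comp measurable_norm))
    · refine (abs_add_le _ _).trans (add_le_add ?_ ?_) <;> rw [abs_mul]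
      · exact mul_le_mul (hFM _) (abs_radialDensity_le (norm_nonneg _)) (abs_nonneg _)
          ((abs_nonneg _).trans (hFM 0))
      · exact mul_le_mul (hFD _) (abs_radialSlope_le (norm_nonneg _)) (abs_nonneg _)
          ((abs_nonneg _).trans (hFD 0))
  have iΩ : Integrable (Ω.indicator fun x => F x * w x) := iu.indicator hΩm
  have hpt : ∀ᵐ x, δ / 2 * (F x * w x) ≤
      (F x * radialDensity s α β ‖x‖ + fderiv ℝ F x x * radialSlope s α β ‖x‖) * w x
      + (B * Ω.indicator (fun x => F x * w x) x
      + K * (‖fderiv ℝ φ x‖ ^ q * hpWeight N α β (γ + q) x)) := by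
    have : Nonempty (Fin N) := ⟨⟨0, hN⟩⟩
    filter_upwards [compl_mem_ae_iff.2 (measure_singleton (0 : EuclideanSpace ℝ (Fin N))),
      energyWeight_ae_eq hN q α β γ] with x hx hxE
    have hx0 : 0 < ‖x‖ := norm_pos_iff.2 hx
    have hF0 : 0 ≤ F x := by positivity
    have hw0 : 0 ≤ w x := hpWeight_nonneg x
    have hind : Ω.indicator (fun x => F x * w x) x = (Icc a b).indicator 1 ‖x‖ * (F x * w x) := by
      by_cases h : x ∈ Ω
      · rw [indicator_of_mem h, indicator_of_mem (show ‖x‖ ∈ Icc a b from h), Pi.one_apply, one_mul]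
      · rw [indicator_of_notMem h, indicator_of_notMem (show ‖x‖ ∉ Icc a b from h), zero_mul]
    have h1 := mul_le_mul_of_nonneg_right (hlow ‖x‖ hx0) hF0
    have h2 : -(q * P * (|φ x - c| ^ (q - 1) * (‖fderiv ℝ φ x‖ * ‖x‖))) ≤
        fderiv ℝ F x x * radialSlope s α β ‖x‖ := by
      refine neg_le_of_abs_le ?_
      rw [abs_mul]
      calc |fderiv ℝ F x x| * |radialSlope s α β ‖x‖|
          ≤ q * (|φ x - c| ^ (q - 1) * (‖fderiv ℝ φ x‖ * ‖x‖)) * P := by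
            refine mul_le_mul (hFx x) ?_ (abs_nonneg _) (by positivity)
            exact (abs_radialSlope_le hx0.le).trans (by rw [hP]; linarith)
        _ = _ := by ring
    have h3 : q * P * (|φ x - c| ^ (q - 1) * (‖fderiv ℝ φ x‖ * ‖x‖)) ≤
        δ / 2 * F x + K * (‖fderiv ℝ φ x‖ * ‖x‖) ^ q := by
      have := rpow_sub_one_mul_le hq (abs_nonneg (φ x - c))
        (by positivity : 0 ≤ ‖fderiv ℝ φ x‖ * ‖x‖) hε0
      calc _ ≤ q * P * (ε * |φ x - c| ^ q + ε ^ (1 - q) * (‖fderiv ℝ φ x‖ * ‖x‖) ^ q) := by gcongr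
        _ = q * P * ε * F x + K * (‖fderiv ℝ φ x‖ * ‖x‖) ^ q := by
          simp only [hK, hF, Real.norm_eq_abs]; ring
        _ = _ := by
          congr 2
          rw [hε]; field_simp
    rw [hind, hxE]
    rw [Real.mul_rpow (norm_nonneg _) (norm_nonneg _)] at h3
    have h4 : δ / 2 * F x ≤
        (F x * radialDensity s α β ‖x‖ + fderiv ℝ F x x * radialSlope s α β ‖x‖)
        + (B * ((Icc a b).indicator 1 ‖x‖ * F x) + K * (‖fderiv ℝ φ x‖ ^ q * ‖x‖ ^ q)) := by
      linarith
    have := mul_le_mul_of_nonneg_right h4 hw0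
    linarith
  have hint := integral_mono_ae (iu.const_mul (δ / 2))
    (iΨ.add ((iΩ.const_mul B).add (iE.const_mul K))) hpt
  have e1 : ∫ x, ((fun x => (F x * radialDensity s α β ‖x‖ +
      fderiv ℝ F x x * radialSlope s α β ‖x‖) * w x) +
      ((fun x => B * Ω.indicator (fun x => F x * w x) x) +
      fun x => K * (‖fderiv ℝ φ x‖ ^ q * hpWeight N α β (γ + q) x))) x
      = B * (∫ x in Ω, F x * w x) + K * gradEnergy q α β γ φ := by
    rw [integral_add' iΨ ((iΩ.const_mul B).add (iE.const_mul K)),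
      integral_add' (iΩ.const_mul B) (iE.const_mul K), hzero, zero_add,
      integral_const_mul, integral_const_mul, integral_indicator hΩm, gradEnergy]
  rw [e1, integral_const_mul] at hint
  have hE := gradEnergy_nonneg (q := q) (α := α) (β := β) (γ := γ) φ
  have hI : 0 ≤ ∫ x in Ω, F x * w x :=
    integral_nonneg fun x => mul_nonneg (by positivity) (hpWeight_nonneg x)
  calc ∫ x, F x * w x = 2 / δ * (δ / 2 * ∫ x, F x * w x) := by field_simp
    _ ≤ 2 / δ * (B * (∫ x in Ω, F x * w x) + K * gradEnergy q α β γ φ) := by gcongr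
    _ ≤ 2 / δ * ((B + K) * ((∫ x in Ω, F x * w x) + gradEnergy q α β γ φ)) := by
        gcongr
        nlinarith
    _ = _ := by simp only [F, Real.norm_eq_abs]; ring

end Reduction

/-! ### Poincaré inequality on bounded convex sets -/

/-- Jensen's inequality along the segment from `y` to `x`. -/
theorem enorm_sub_rpow_le_lintegral_segment {E : Type*} [NormedAddCommGroup E]
    [NormedSpace ℝ E] {q : ℝ} (hq : 1 ≤ q) {φ : E → ℝ} (hφ : ContDiff ℝ 1 φ)
    (x y : E) :
    ‖φ x - φ y‖ₑ ^ q ≤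
      ‖x - y‖ₑ ^ q * ∫⁻ t in Icc (0 : ℝ) 1, ‖fderiv ℝ φ (y + t • (x - y))‖ₑ ^ q := by
  have hq0 : 0 < q := by linarith
  have hdφ : Continuous (fderiv ℝ φ) := hφ.continuous_fderiv one_ne_zero
  have hc : Continuous fun t : ℝ => fderiv ℝ φ (y + t • (x - y)) := hdφ.comp (by fun_prop)
  have hderiv : ∀ t : ℝ, HasDerivAt (fun t : ℝ => φ (y + t • (x - y)))
      (fderiv ℝ φ (y + t • (x - y)) (x - y)) t := by
    intro t
    have hl : HasDerivAt (fun t : ℝ => y + t • (x - y)) (x - y) t := by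
      simpa using ((hasDerivAt_id t).smul_const (x - y)).const_add y
    exact (hφ.differentiable one_ne_zero _).hasFDerivAt.comp_hasDerivAt t hl
  have hftc : φ x - φ y = ∫ t in (0 : ℝ)..1, fderiv ℝ φ (y + t • (x - y)) (x - y) := by
    rw [intervalIntegral.integral_eq_sub_of_hasDerivAt (fun t _ => hderiv t)
      ((hc.clm_apply continuous_const).intervalIntegrable _ _)]
    simp
  have h1 : ‖φ x - φ y‖ₑ ≤
      ‖x - y‖ₑ * ∫⁻ t in Icc (0 : ℝ) 1, ‖fderiv ℝ φ (y + t • (x - y))‖ₑ := by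
    rw [hftc, intervalIntegral.integral_of_le zero_le_one, ← integral_Icc_eq_integral_Ioc,
      ← lintegral_const_mul _ hc.enorm.measurable]
    refine (enorm_integral_le_lintegral_enorm _).trans (lintegral_mono fun t => ?_)
    rw [mul_comm]
    exact ContinuousLinearMap.le_opENorm _ _
  have hprob : IsProbabilityMeasure (volume.restrict (Icc (0 : ℝ) 1)) := ⟨by simp⟩
  have h2 := eLpNorm'_le_eLpNorm'_of_exponent_le (μ := volume.restrict (Icc (0 : ℝ) 1))
    zero_lt_one hq hc.aestronglyMeasurable
  rw [eLpNorm', eLpNorm'] at h2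
  simp only [ENNReal.rpow_one, div_one] at h2
  calc ‖φ x - φ y‖ₑ ^ q
      ≤ (‖x - y‖ₑ * ∫⁻ t in Icc (0 : ℝ) 1, ‖fderiv ℝ φ (y + t • (x - y))‖ₑ) ^ q := by gcongr
    _ ≤ (‖x - y‖ₑ *
        (∫⁻ t in Icc (0 : ℝ) 1, ‖fderiv ℝ φ (y + t • (x - y))‖ₑ ^ q) ^ (1 / q)) ^ q := by gcongr
    _ = _ := by
        rw [ENNReal.mul_rpow_of_nonneg _ _ hq0.le, ← ENNReal.rpow_mul, one_div,
          inv_mul_cancel₀ hq0.ne', ENNReal.rpow_one]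

section Poincare

variable {E : Type*} [NormedAddCommGroup E] [NormedSpace ℝ E] [FiniteDimensional ℝ E]
  [MeasurableSpace E] [BorelSpace E] {μ : Measure E} [μ.IsAddHaarMeasure] {q : ℝ}

theorem lintegral_comp_add_smul_le (g : E → ℝ≥0∞) (hg : Measurable g) (z : E) {t : ℝ}
    (ht : 1 / 2 ≤ t) :
    ∫⁻ x, g (z + t • x) ∂μ ≤ 2 ^ Module.finrank ℝ E * ∫⁻ x, g x ∂μ := by
  have ht0 : 0 < t := by linarith
  have h1 : ∫⁻ x, g (z + t • x) ∂μ = ∫⁻ x, g (z + x) ∂(Measure.map (t • ·) μ) :=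
    (lintegral_map (hg.comp (measurable_const_add z)) (measurable_const_smul t)).symm
  rw [h1, Measure.map_addHaar_smul _ ht0.ne', lintegral_smul_measure, smul_eq_mul,
    lintegral_add_left_eq_self g z]
  gcongr
  rw [← ENNReal.ofReal_ofNat, ← ENNReal.ofReal_pow (by norm_num)]
  refine ENNReal.ofReal_le_ofReal ?_
  rw [abs_of_pos (by positivity), ← inv_pow]
  refine pow_le_pow_left₀ (by positivity) ?_ _
  rw [inv_le_comm₀ ht0 (by norm_num)]
  linarith

/-- Averaging the segment inequality over pairs of points; the change of variables is made in
the endpoint whose coefficient is at least `1 / 2`. -/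
theorem lintegral_lintegral_enorm_sub_rpow_le (hq : 1 ≤ q) {D : Set E} (hD : Convex ℝ D)
    (hDm : MeasurableSet D) (hμ : μ D ≠ ⊤) {d : ℝ≥0∞} (hd : ∀ x ∈ D, ∀ y ∈ D, ‖x - y‖ₑ ≤ d)
    {φ : E → ℝ} (hφ : ContDiff ℝ 1 φ) :
    ∫⁻ y in D, ∫⁻ x in D, ‖φ x - φ y‖ₑ ^ q ∂μ ∂μ ≤
      μ D * (d ^ q * 2 ^ Module.finrank ℝ E * ∫⁻ x in D, ‖fderiv ℝ φ x‖ₑ ^ q ∂μ) := by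
  have hq0 : 0 < q := by linarith
  have : IsFiniteMeasure (μ.restrict D) := ⟨by simpa using hμ.lt_top⟩
  set g : E → ℝ≥0∞ := D.indicator fun x => ‖fderiv ℝ φ x‖ₑ ^ q with hg
  have hgm : Measurable g :=
    (((hφ.continuous_fderiv one_ne_zero).enorm.measurable).pow_const q).indicator hDm
  set I : ℝ≥0∞ := ∫⁻ x in D, ‖fderiv ℝ φ x‖ₑ ^ q ∂μ with hI
  have hgI : ∫⁻ x, g x ∂μ = I := lintegral_indicator hDm _
  have hm3 : Measurable fun p : (E × E) × ℝ => g (p.1.1 + p.2 • (p.1.2 - p.1.1)) :=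
    hgm.comp (by fun_prop)
  have hpt : ∀ y ∈ D, ∀ x ∈ D, ‖φ x - φ y‖ₑ ^ q ≤
      d ^ q * ∫⁻ t in Icc (0 : ℝ) 1, g (y + t • (x - y)) := by
    intro y hy x hx
    refine (enorm_sub_rpow_le_lintegral_segment hq hφ x y).trans ?_
    gcongr ?_ ^ q * ?_
    · exact hd x hx y hy
    · refine setLIntegral_mono_ae' measurableSet_Icc (Eventually.of_forall fun t ht => ?_)
      have hmem : y + t • (x - y) ∈ D := hD.add_smul_sub_mem hy hx ht
      rw [hg, indicator_of_mem hmem]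
  have hcore : ∀ t ∈ Icc (0 : ℝ) 1, ∫⁻ y in D, ∫⁻ x in D, g (y + t • (x - y)) ∂μ ∂μ ≤
      μ D * (2 ^ Module.finrank ℝ E * I) := by
    intro t ht
    rcases le_total (1 / 2) t with h | h
    · calc ∫⁻ y in D, ∫⁻ x in D, g (y + t • (x - y)) ∂μ ∂μ
          ≤ ∫⁻ y in D, 2 ^ Module.finrank ℝ E * I ∂μ := by
            refine lintegral_mono fun y => ?_
            refine (setLIntegral_le_lintegral D _).trans ?_
            rw [← hgI]
            refine le_trans (le_of_eq (lintegral_congr fun x => ?_))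
              (lintegral_comp_add_smul_le g hgm (y - t • y) h)
            congr 1
            module
        _ = _ := by rw [setLIntegral_const, mul_comm]
    · rw [lintegral_lintegral_swap (by
        refine Measurable.aemeasurable ?_
        exact hgm.comp (by fun_prop : Measurable fun p : E × E => p.1 + t • (p.2 - p.1)))]
      calc ∫⁻ x in D, ∫⁻ y in D, g (y + t • (x - y)) ∂μ ∂μ
          ≤ ∫⁻ x in D, 2 ^ Module.finrank ℝ E * I ∂μ := by
            refine lintegral_mono fun x => ?_
            refine (setLIntegral_le_lintegral D _).trans ?_
            rw [← hgI]
            refine le_trans (le_of_eq (lintegral_congr fun y => ?_))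
              (lintegral_comp_add_smul_le g hgm (t • x) (t := 1 - t) (by linarith))
            congr 1
            module
        _ = _ := by rw [setLIntegral_const, mul_comm]
  calc ∫⁻ y in D, ∫⁻ x in D, ‖φ x - φ y‖ₑ ^ q ∂μ ∂μ
      ≤ ∫⁻ y in D, ∫⁻ x in D, (d ^ q * ∫⁻ t in Icc (0 : ℝ) 1, g (y + t • (x - y))) ∂μ ∂μ :=
        setLIntegral_mono' hDm fun y hy => setLIntegral_mono' hDm fun x hx => hpt y hy x hx
    _ = d ^ q * ∫⁻ p : E × E in D ×ˢ D, (∫⁻ t in Icc (0 : ℝ) 1,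
          g (p.1 + t • (p.2 - p.1))) ∂(μ.prod μ) := by
        have hm2 : Measurable fun p : E × E => ∫⁻ t in Icc (0 : ℝ) 1, g (p.1 + t • (p.2 - p.1)) :=
          hm3.lintegral_prod_right'
        rw [← Measure.prod_restrict, lintegral_prod _ hm2.aemeasurable,
          ← lintegral_const_mul _ hm2.lintegral_prod_right']
        refine lintegral_congr fun y => ?_
        rw [lintegral_const_mul]
        exact hm2.comp measurable_prodMk_left
    _ = d ^ q * ∫⁻ t in Icc (0 : ℝ) 1, ∫⁻ p : E × E in D ×ˢ D,
          g (p.1 + t • (p.2 - p.1)) ∂(μ.prod μ) := by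
        rw [lintegral_lintegral_swap hm3.aemeasurable]
    _ ≤ d ^ q * ∫⁻ t in Icc (0 : ℝ) 1, μ D * (2 ^ Module.finrank ℝ E * I) := by
        refine mul_le_mul_right ?_ (d ^ q)
        refine setLIntegral_mono' measurableSet_Icc fun t ht => ?_
        have hm : Measurable fun p : E × E => g (p.1 + t • (p.2 - p.1)) := hgm.comp (by fun_prop)
        rw [← Measure.prod_restrict, lintegral_prod _ hm.aemeasurable]
        exact hcore t ht
    _ = _ := by
        rw [setLIntegral_const, Real.volume_Icc]
        simp only [sub_zero, ENNReal.ofReal_one, mul_one]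
        ring

/-- The set `D` supports a Poincaré inequality for `C¹` functions, with the gradient measured on
the possibly larger set `S`: there is one constant such that every `φ` is close to some number in
`L^q(D)`. -/
def IsPoincareSet (μ : Measure E) (q : ℝ) (S D : Set E) : Prop :=
  ∃ C : ℝ≥0∞, C ≠ ⊤ ∧ ∀ φ : E → ℝ, ContDiff ℝ 1 φ →
    ∃ c : ℝ, ∫⁻ x in D, ‖φ x - c‖ₑ ^ q ∂μ ≤ C * ∫⁻ x in S, ‖fderiv ℝ φ x‖ₑ ^ q ∂μ

theorem Convex.isPoincareSet (hq : 1 ≤ q) {S D : Set E} (hD : Convex ℝ D)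
    (hDm : MeasurableSet D) (hb : Bornology.IsBounded D) (hpos : μ D ≠ 0) (hDS : D ⊆ S) :
    IsPoincareSet μ q S D := by
  have hμ : μ D ≠ ⊤ := hb.measure_lt_top.ne
  have hq0 : 0 < q := by linarith
  have hd : ∀ x ∈ D, ∀ y ∈ D, ‖x - y‖ₑ ≤ Metric.ediam D := fun x hx y hy => by
    rw [← edist_eq_enorm_sub]
    exact Metric.edist_le_ediam_of_mem hx hy
  refine ⟨Metric.ediam D ^ q * 2 ^ Module.finrank ℝ E, ?_, fun φ hφ => ?_⟩
  · refine ENNReal.mul_ne_top (ENNReal.rpow_ne_top_of_nonneg hq0.le hb.ediam_ne_top) ?_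
    exact ENNReal.pow_ne_top ENNReal.ofNat_ne_top
  · have hm : Measurable fun p : E × E => ‖φ p.2 - φ p.1‖ₑ ^ q := by
      have : Continuous fun p : E × E => φ p.2 - φ p.1 :=
        (hφ.continuous.comp continuous_snd).sub (hφ.continuous.comp continuous_fst)
      exact this.enorm.measurable.pow_const q
    have : IsFiniteMeasure (μ.restrict D) := ⟨by simpa using hμ.lt_top⟩
    obtain ⟨y, -, hy⟩ := exists_le_setLAverage (μ := μ) (s := D)
      (f := fun y => ∫⁻ x in D, ‖φ x - φ y‖ₑ ^ q ∂μ) hpos hμ hm.lintegral_prod_right'.aemeasurable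
    refine ⟨φ y, hy.trans ?_⟩
    rw [setLAverage_eq]
    refine ENNReal.div_le_of_le_mul' ?_
    refine (lintegral_lintegral_enorm_sub_rpow_le hq hD hDm hμ hd hφ).trans ?_
    gcongr

end Poincare

/-- Two Poincaré sets with a non-negligible overlap can be glued: on the overlap the two reference
constants are compared. -/
theorem IsPoincareSet.union {E : Type*} [NormedAddCommGroup E] [NormedSpace ℝ E]
    [MeasurableSpace E] [BorelSpace E] {μ : Measure E} {q : ℝ} (hq : 1 ≤ q) {S D D' : Set E}
    (h : IsPoincareSet μ q S D)
    (h' : IsPoincareSet μ q S D') (hD' : μ D' ≠ ⊤) (hpos : μ (D ∩ D') ≠ 0) :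
    IsPoincareSet μ q S (D ∪ D') := by
  obtain ⟨C, hC, H⟩ := h
  obtain ⟨C', hC', H'⟩ := h'
  have hq0 : 0 < q := by linarith
  have htop : μ (D ∩ D') ≠ ⊤ := measure_ne_top_of_subset inter_subset_right hD'
  have h2 : (2 : ℝ≥0∞) ^ (q - 1) ≠ ⊤ :=
    ENNReal.rpow_ne_top_of_nonneg (by linarith) ENNReal.ofNat_ne_top
  set J : ℝ≥0∞ := μ D' * (2 ^ (q - 1) * (C + C') / μ (D ∩ D')) with hJ
  refine ⟨C + 2 ^ (q - 1) * (C' + J), ?_, fun φ hφ => ?_⟩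
  · refine ENNReal.add_ne_top.2 ⟨hC, ENNReal.mul_ne_top h2 (ENNReal.add_ne_top.2 ⟨hC', ?_⟩)⟩
    exact ENNReal.mul_ne_top hD' (ENNReal.div_ne_top
      (ENNReal.mul_ne_top h2 (ENNReal.add_ne_top.2 ⟨hC, hC'⟩)) hpos)
  obtain ⟨c, hc⟩ := H φ hφ
  obtain ⟨c', hc'⟩ := H' φ hφ
  set e : ℝ≥0∞ := ∫⁻ x in S, ‖fderiv ℝ φ x‖ₑ ^ q ∂μ
  have hm : ∀ c : ℝ, Measurable fun x => ‖φ x - c‖ₑ ^ q := fun c =>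
    (hφ.continuous.sub continuous_const).enorm.measurable.pow_const q
  have tri : ∀ u v : ℝ, ‖u + v‖ₑ ^ q ≤ 2 ^ (q - 1) * (‖u‖ₑ ^ q + ‖v‖ₑ ^ q) := fun u v =>
    (ENNReal.rpow_le_rpow (enorm_add_le u v) hq0.le).trans
      (ENNReal.rpow_add_le_mul_rpow_add_rpow _ _ hq)
  have hcc : ‖c' - c‖ₑ ^ q ≤ 2 ^ (q - 1) * (C + C') / μ (D ∩ D') * e := by
    rw [div_eq_mul_inv, mul_right_comm, ← div_eq_mul_inv,
      ENNReal.le_div_iff_mul_le (Or.inl hpos) (Or.inl htop)]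
    calc ‖c' - c‖ₑ ^ q * μ (D ∩ D') = ∫⁻ _ in D ∩ D', ‖c' - c‖ₑ ^ q ∂μ :=
          (setLIntegral_const _ _).symm
      _ ≤ ∫⁻ x in D ∩ D', 2 ^ (q - 1) * (‖φ x - c‖ₑ ^ q + ‖φ x - c'‖ₑ ^ q) ∂μ := by
          refine lintegral_mono fun x => ?_
          have := tri (φ x - c) (-(φ x - c'))
          rwa [enorm_neg, show φ x - c + -(φ x - c') = c' - c by ring] at this
      _ = 2 ^ (q - 1) * ((∫⁻ x in D ∩ D', ‖φ x - c‖ₑ ^ q ∂μ) +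
            ∫⁻ x in D ∩ D', ‖φ x - c'‖ₑ ^ q ∂μ) := by
          rw [lintegral_const_mul' _ _ h2, lintegral_add_left (hm c)]
      _ ≤ 2 ^ (q - 1) * (C * e + C' * e) := by
          gcongr
          · exact (lintegral_mono_set inter_subset_left).trans hc
          · exact (lintegral_mono_set inter_subset_right).trans hc'
      _ = _ := by ring
  refine ⟨c, (lintegral_union_le _ _ _).trans ?_⟩
  calc (∫⁻ x in D, ‖φ x - c‖ₑ ^ q ∂μ) + ∫⁻ x in D', ‖φ x - c‖ₑ ^ q ∂μ
      ≤ C * e + ∫⁻ x in D', 2 ^ (q - 1) * (‖φ x - c'‖ₑ ^ q + ‖c' - c‖ₑ ^ q) ∂μ := by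
        gcongr with x
        have := tri (φ x - c') (c' - c)
        rwa [sub_add_sub_cancel] at this
    _ = C * e + 2 ^ (q - 1) * ((∫⁻ x in D', ‖φ x - c'‖ₑ ^ q ∂μ) + ‖c' - c‖ₑ ^ q * μ D') := by
        rw [lintegral_const_mul' _ _ h2, lintegral_add_left (hm c'),
          setLIntegral_const]
    _ ≤ C * e + 2 ^ (q - 1) *
          (C' * e + 2 ^ (q - 1) * (C + C') / μ (D ∩ D') * e * μ D') := by gcongr
    _ = _ := by rw [hJ]; ring

theorem IsPoincareSet.mono {E : Type*} [NormedAddCommGroup E] [NormedSpace ℝ E]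
    [MeasurableSpace E] {μ : Measure E} {q : ℝ} {S D D' : Set E} (h : IsPoincareSet μ q S D)
    (hD : D' ⊆ D) :
    IsPoincareSet μ q S D' := by
  obtain ⟨C, hC, H⟩ := h
  refine ⟨C, hC, fun φ hφ => ?_⟩
  obtain ⟨c, hc⟩ := H φ hφ
  exact ⟨c, (lintegral_mono_set hD).trans hc⟩

/-! ### Poincaré inequality on an annulus -/

section Annulus

variable {N : ℕ} {q : ℝ}

/-- For `ε = ±1`, the cap of the ball of radius `R` cut off by the half-space `κ < ε * x i`, where
`p = (i, ε)`. Finitely many of these convex sets cover an annulus. -/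
def ballCap (κ R : ℝ) (p : Fin N × ℝ) : Set (EuclideanSpace ℝ (Fin N)) :=
  {x | κ < p.2 * x p.1 ∧ ‖x‖ < R}

theorem isOpen_ballCap (κ R : ℝ) (p : Fin N × ℝ) : IsOpen (ballCap κ R p) :=
  (isOpen_lt (f := fun _ => κ) (g := fun x : EuclideanSpace ℝ (Fin N) => p.2 * x p.1)
    continuous_const (by fun_prop)).inter (isOpen_lt continuous_norm continuous_const)

theorem convex_ballCap (κ R : ℝ) (p : Fin N × ℝ) : Convex ℝ (ballCap κ R p) := by
  have h1 : Convex ℝ {x : EuclideanSpace ℝ (Fin N) | κ < p.2 * x p.1} :=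
    convex_halfSpace_gt (f := fun x : EuclideanSpace ℝ (Fin N) => p.2 * x p.1)
      ⟨fun x y => by simp [mul_add], fun c x => by simp; ring⟩ κ
  have h2 : Convex ℝ {x : EuclideanSpace ℝ (Fin N) | ‖x‖ < R} := by
    simpa [Metric.ball, dist_zero_right] using convex_ball (0 : EuclideanSpace ℝ (Fin N)) R
  exact h1.inter h2

theorem isBounded_ballCap (κ R : ℝ) (p : Fin N × ℝ) : Bornology.IsBounded (ballCap κ R p) :=
  Metric.isBounded_ball.subset fun x hx => (by simpa using hx.2 : x ∈ Metric.ball 0 R)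

theorem ballCap_inter_nonempty {κ R : ℝ} (hκ : 0 < κ) (hR : 4 * κ < R) {i j : Fin N} (hij : i ≠ j)
    {ε ε' : ℝ} (hε : ε = 1 ∨ ε = -1) (hε' : ε' = 1 ∨ ε' = -1) :
    (ballCap κ R (i, ε) ∩ ballCap κ R (j, ε')).Nonempty := by
  have hsq : ε * ε = 1 ∧ |ε| = 1 := by rcases hε with rfl | rfl <;> simp
  have hsq' : ε' * ε' = 1 ∧ |ε'| = 1 := by rcases hε' with rfl | rfl <;> simp
  set z : EuclideanSpace ℝ (Fin N) :=
    EuclideanSpace.single i (2 * κ * ε) + EuclideanSpace.single j (2 * κ * ε') with hz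
  have hn : ‖z‖ < R := by
    refine (norm_add_le _ _).trans_lt ?_
    rw [PiLp.norm_single, PiLp.norm_single, norm_mul, norm_mul _ ε', Real.norm_eq_abs ε,
      Real.norm_eq_abs ε', hsq.2, hsq'.2, Real.norm_of_nonneg (by positivity)]
    linarith
  refine ⟨z, ⟨?_, hn⟩, ⟨?_, hn⟩⟩
  · simp only [hz, PiLp.add_apply, PiLp.single_apply, hij, if_true, if_false]
    nlinarith [hsq.1]
  · simp only [hz, PiLp.add_apply, PiLp.single_apply, hij.symm, if_true, if_false]
    nlinarith [hsq'.1]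

theorem ballCap_subset_shell {κ R : ℝ} {p : Fin N × ℝ} (hp : |p.2| = 1) :
    ballCap κ R p ⊆ {x | κ ≤ ‖x‖ ∧ ‖x‖ ≤ R} := by
  rintro x ⟨h1, h2⟩
  refine ⟨?_, h2.le⟩
  calc κ ≤ p.2 * x p.1 := h1.le
    _ ≤ |p.2 * x p.1| := le_abs_self _
    _ = ‖x p.1‖ := by rw [abs_mul, hp, one_mul, Real.norm_eq_abs]
    _ ≤ ‖x‖ := PiLp.norm_apply_le x p.1

/-- For `N ≥ 2` an annulus is a union of convex caps, each of which meets one of two fixed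
overlapping caps; hence it supports a Poincaré inequality, with the gradient on a larger shell. -/
theorem exists_isPoincareSet_annulus (hN : 2 ≤ N) (hq : 1 ≤ q) {a b : ℝ} (ha : 0 < a)
    (hab : a < b) :
    ∃ κ R : ℝ, 0 < κ ∧ IsPoincareSet (volume : Measure (EuclideanSpace ℝ (Fin N))) q
      {x | κ ≤ ‖x‖ ∧ ‖x‖ ≤ R} {x | a ≤ ‖x‖ ∧ ‖x‖ ≤ b} := by
  have hN0 : (0 : ℝ) < N := by exact_mod_cast (by lia : 0 < N)
  set κ : ℝ := a / (2 * N) with hκ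
  have hκ0 : 0 < κ := by positivity
  set R : ℝ := b + 4 * κ with hR
  have hR4 : 4 * κ < R := by linarith
  set S : Set (EuclideanSpace ℝ (Fin N)) := {x | κ ≤ ‖x‖ ∧ ‖x‖ ≤ R} with hS
  refine ⟨κ, R, hκ0, ?_⟩
  set i₀ : Fin N := ⟨0, by lia⟩
  set i₁ : Fin N := ⟨1, by lia⟩
  have h01 : i₀ ≠ i₁ := by simp [i₀, i₁]
  have habs : ∀ ε : ℝ, ε = 1 ∨ ε = -1 → |ε| = 1 := by rintro ε (rfl | rfl) <;> simp
  have hpos : ∀ {i j : Fin N}, i ≠ j → ∀ {ε ε' : ℝ}, (ε = 1 ∨ ε = -1) → (ε' = 1 ∨ ε' = -1) →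
      volume (ballCap κ R (i, ε) ∩ ballCap κ R (j, ε')) ≠ 0 := fun hij _ _ hε hε' =>
    (((isOpen_ballCap κ R _).inter (isOpen_ballCap κ R _)).measure_pos volume
      (ballCap_inter_nonempty hκ0 hR4 hij hε hε')).ne'
  have hneigh : ∀ i : Fin N, ∃ j ∈ ({i₀, i₁} : Set (Fin N)), j ≠ i := by
    intro i
    by_cases h : i = i₀
    · exact ⟨i₁, by simp, h ▸ h01.symm⟩
    · exact ⟨i₀, by simp, Ne.symm h⟩
  have hcap : ∀ (i : Fin N) (ε : ℝ), (ε = 1 ∨ ε = -1) →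
      IsPoincareSet volume q S (ballCap κ R (i, ε)) := by
    intro i ε hε
    obtain ⟨j, -, hj⟩ := hneigh i
    exact (convex_ballCap κ R _).isPoincareSet hq (isOpen_ballCap κ R _).measurableSet
      (isBounded_ballCap κ R _) (fun h0 => hpos hj (Or.inl rfl) hε
        (measure_inter_null_of_null_right _ h0))
      (ballCap_subset_shell (habs ε hε))
  have hfin : ∀ p : Fin N × ℝ, volume (ballCap κ R p) ≠ ⊤ := fun p =>
    (isBounded_ballCap κ R p).measure_lt_top.ne
  set U : Set (EuclideanSpace ℝ (Fin N)) := ballCap κ R (i₀, 1) ∪ ballCap κ R (i₁, 1) with hU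
  have hUP : IsPoincareSet volume q S U :=
    (hcap i₀ 1 (Or.inl rfl)).union hq (hcap i₁ 1 (Or.inl rfl)) (hfin _)
      (hpos h01 (Or.inl rfl) (Or.inl rfl))
  have hind : ∀ T : Finset (Fin N × ℝ), (∀ p ∈ T, p.2 = 1 ∨ p.2 = -1) →
      IsPoincareSet volume q S (U ∪ ⋃ p ∈ T, ballCap κ R p) := by
    intro T
    induction T using Finset.induction_on with
    | empty => simpa using hUP
    | insert p T hp ih =>
      intro hT
      have hε := hT p (Finset.mem_insert_self p T)
      have h1 := ih fun p' hp' => hT p' (Finset.mem_insert_of_mem hp')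
      have h2 := h1.union hq (hcap p.1 p.2 hε) (hfin _) ?_
      · refine h2.mono ?_
        rw [Finset.set_biUnion_insert, union_comm (ballCap κ R p), ← union_assoc]
      · obtain ⟨j, hj, hji⟩ := hneigh p.1
        have hjU : ballCap κ R (j, 1) ⊆ U := by
          rcases hj with rfl | rfl
          · exact subset_union_left
          · exact subset_union_right
        intro h0
        refine hpos hji (Or.inl rfl) hε (measure_mono_null ?_ h0)
        exact inter_subset_inter_left _ (hjU.trans subset_union_left)
  refine (hind (Finset.univ ×ˢ {1, -1}) (by simp)).mono ?_
  rintro x ⟨hx1, hx2⟩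
  -- A point of the annulus has some coordinate larger than `κ` in absolute value.
  obtain ⟨i, hi⟩ : ∃ i, κ < |x i| := by
    by_contra! hcon
    have h1 : ‖x‖ ^ 2 ≤ N * κ ^ 2 := by
      rw [EuclideanSpace.norm_sq_eq]
      calc ∑ i, ‖x i‖ ^ 2 ≤ ∑ _i : Fin N, κ ^ 2 := by
            refine Finset.sum_le_sum fun i _ => ?_
            exact pow_le_pow_left₀ (norm_nonneg _) (hcon i) 2
        _ = N * κ ^ 2 := by simp
    have h2 : N * κ = a / 2 := by rw [hκ]; field_simp
    have h3 : κ ≤ a / 2 := by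
      rw [← h2]
      exact le_mul_of_one_le_left hκ0.le (by exact_mod_cast (by lia : 1 ≤ N))
    nlinarith
  have hxR : ‖x‖ < R := by linarith
  refine Or.inr (mem_iUnion₂.2 ?_)
  rcases lt_abs.1 hi with h | h
  · exact ⟨(i, 1), by simp, by simpa using h, hxR⟩
  · exact ⟨(i, -1), by simp, by simpa using h, hxR⟩

end Annulus

/-! ### The inequality for continuously differentiable functions -/

section Smooth

variable {N : ℕ} {q α β γ : ℝ}

theorem exists_hpWeight_le_and_one_le_mul (α β γ : ℝ) {a b : ℝ} (ha : 0 < a) :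
    ∃ K : ℝ, 0 < K ∧ ∀ x : EuclideanSpace ℝ (Fin N), a ≤ ‖x‖ → ‖x‖ ≤ b →
      hpWeight N α β γ x ≤ K ∧ 1 ≤ K * hpWeight N α β γ x := by
  set f : ℝ → ℝ := fun r => r ^ γ * (1 + r ^ β) ^ α with hf
  have hpos : ∀ r ∈ Icc a b, 0 < f r := fun r hr => by
    have : 0 < r := ha.trans_le hr.1
    positivity
  have hc : ContinuousOn f (Icc a b) := by
    intro r hr
    have hr0 : 0 < r := ha.trans_le hr.1
    have h1 : ContinuousAt (fun r : ℝ => 1 + r ^ β) r :=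
      continuousAt_const.add (Real.continuousAt_rpow_const r β (Or.inl hr0.ne'))
    exact ((Real.continuousAt_rpow_const r γ (Or.inl hr0.ne')).mul
      (h1.rpow_const (Or.inl (by positivity)))).continuousWithinAt
  obtain ⟨K₁, h₁⟩ := isCompact_Icc.exists_bound_of_continuousOn hc
  obtain ⟨K₂, h₂⟩ := isCompact_Icc.exists_bound_of_continuousOn
    (hc.inv₀ fun r hr => (hpos r hr).ne')
  refine ⟨|K₁| + |K₂| + 1, by positivity, fun x hx hx' => ?_⟩
  have hf0 : 0 < hpWeight N α β γ x := hpos ‖x‖ ⟨hx, hx'⟩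
  have e1 : hpWeight N α β γ x ≤ K₁ := (le_abs_self _).trans (h₁ ‖x‖ ⟨hx, hx'⟩)
  have e2 : (hpWeight N α β γ x)⁻¹ ≤ K₂ := (le_abs_self _).trans (h₂ ‖x‖ ⟨hx, hx'⟩)
  constructor
  · linarith [le_abs_self K₁, abs_nonneg K₂]
  · calc 1 = (hpWeight N α β γ x)⁻¹ * hpWeight N α β γ x := (inv_mul_cancel₀ hf0.ne').symm
      _ ≤ (|K₁| + |K₂| + 1) * hpWeight N α β γ x := by
        gcongr
        linarith [le_abs_self K₂, abs_nonneg K₁]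

/-- The unweighted Poincaré inequality on an annulus gives the weighted one, because both weights
are comparable to constants there. -/
theorem exists_annulus_integral_le_gradEnergy (hN : 2 ≤ N) (hq : 1 < q) (hα : α < 0)
    (hγ : 0 < N + γ) (hαβγ : N + γ + α * β < 0) {a b : ℝ} (ha : 0 < a) (hab : a < b) :
    ∃ A : ℝ, 0 < A ∧ ∀ φ : EuclideanSpace ℝ (Fin N) → ℝ,
      ContDiff ℝ 1 φ → HasCompactSupport φ → ∃ c : ℝ,
      ∫ x in {x | a ≤ ‖x‖ ∧ ‖x‖ ≤ b}, |φ x - c| ^ q * hpWeight N α β γ x ≤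
        A * gradEnergy q α β γ φ := by
  have hq0 : 0 ≤ q := by linarith
  obtain ⟨κ, R, hκ, C, hC, hP⟩ := exists_isPoincareSet_annulus hN hq.le ha hab
  obtain ⟨K, hK, hKw⟩ := exists_hpWeight_le_and_one_le_mul (N := N) α β γ (b := b) ha
  obtain ⟨L, hL, hLw⟩ := exists_hpWeight_le_and_one_le_mul (N := N) α β (γ + q) (b := R) hκ
  refine ⟨K * (C.toReal * L) + 1, by positivity, fun φ hφ hs => ?_⟩
  obtain ⟨c, hc⟩ := hP φ hφ
  refine ⟨c, ?_⟩
  have hshell : ∀ s t : ℝ, IsCompact {x : EuclideanSpace ℝ (Fin N) | s ≤ ‖x‖ ∧ ‖x‖ ≤ t} := by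
    intro s t
    refine (isCompact_closedBall (0 : EuclideanSpace ℝ (Fin N)) t).of_isClosed_subset
      ((isClosed_le continuous_const continuous_norm).inter
        (isClosed_le continuous_norm continuous_const)) fun x hx => by simpa using hx.2
  set Ω := {x : EuclideanSpace ℝ (Fin N) | a ≤ ‖x‖ ∧ ‖x‖ ≤ b} with hΩ
  set S := {x : EuclideanSpace ℝ (Fin N) | κ ≤ ‖x‖ ∧ ‖x‖ ≤ R} with hS
  have cu : Continuous fun x => |φ x - c| ^ q :=
    ((hφ.continuous.sub continuous_const).abs).rpow_const fun x => Or.inr hq0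
  have cg : Continuous fun x => ‖fderiv ℝ φ x‖ ^ q :=
    (hφ.continuous_fderiv one_ne_zero).norm.rpow_const fun x => Or.inr hq0
  have iu : IntegrableOn (fun x => |φ x - c| ^ q) Ω :=
    cu.continuousOn.integrableOn_compact (hshell a b)
  have ig : IntegrableOn (fun x => ‖fderiv ℝ φ x‖ ^ q) S :=
    cg.continuousOn.integrableOn_compact (hshell κ R)
  have iw := integrable_abs_sub_rpow_mul (by lia) hq hα hγ hαβγ hφ.continuous.aestronglyMeasurable
    (Eventually.of_forall (hφ.continuous.bounded_above_of_compact_support hs).choose_spec) c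
  have iE := integrable_norm_fderiv_mul (by lia) hq hα hγ hαβγ hφ hs
  have h1 : ∫ x in Ω, |φ x - c| ^ q * hpWeight N α β γ x ≤ K * ∫ x in Ω, |φ x - c| ^ q := by
    rw [← integral_const_mul]
    refine setIntegral_mono_on iw.integrableOn (iu.const_mul K) (hshell a b).measurableSet
      fun x hx => ?_
    rw [mul_comm]
    exact mul_le_mul_of_nonneg_right (hKw x hx.1 hx.2).1 (by positivity)
  have h2 : ∫ x in Ω, |φ x - c| ^ q ≤ C.toReal * ∫ x in S, ‖fderiv ℝ φ x‖ ^ q := by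
    rw [integral_eq_lintegral_of_nonneg_ae (Eventually.of_forall fun x => by positivity)
      iu.aestronglyMeasurable, integral_eq_lintegral_of_nonneg_ae
      (Eventually.of_forall fun x => by positivity) ig.aestronglyMeasurable, ← ENNReal.toReal_mul]
    have hfin := ig.lintegral_lt_top.ne
    refine ENNReal.toReal_mono (ENNReal.mul_ne_top hC hfin) ?_
    refine le_trans (le_of_eq ?_) (hc.trans (le_of_eq ?_))
    · refine lintegral_congr fun x => ?_
      rw [← ENNReal.ofReal_rpow_of_nonneg (abs_nonneg _) hq0, Real.enorm_eq_ofReal_abs]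
    · congr 1
      refine lintegral_congr fun x => ?_
      rw [← ENNReal.ofReal_rpow_of_nonneg (norm_nonneg _) hq0, ofReal_norm]
  have h3 : ∫ x in S, ‖fderiv ℝ φ x‖ ^ q ≤ L * gradEnergy q α β γ φ := by
    rw [gradEnergy, ← integral_const_mul]
    refine (setIntegral_mono_on ig (iE.const_mul L).integrableOn (hshell κ R).measurableSet
      fun x hx => ?_).trans (setIntegral_le_integral (iE.const_mul L) (Eventually.of_forall
        fun x => mul_nonneg hL.le (mul_nonneg (by positivity) (hpWeight_nonneg x))))
    have := mul_le_mul_of_nonneg_left (hLw x hx.1 hx.2).2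
      (by positivity : 0 ≤ ‖fderiv ℝ φ x‖ ^ q)
    linarith
  have hE := gradEnergy_nonneg (q := q) (α := α) (β := β) (γ := γ) φ
  calc ∫ x in Ω, |φ x - c| ^ q * hpWeight N α β γ x
      ≤ K * (C.toReal * (L * gradEnergy q α β γ φ)) := by
        refine h1.trans ?_
        gcongr
        exact h2.trans (by gcongr)
    _ ≤ _ := by linarith

theorem abs_add_rpow_le (hq : 0 ≤ q) (u v : ℝ) : |u + v| ^ q ≤ 2 ^ q * (|u| ^ q + |v| ^ q) := by
  have key : ∀ s t : ℝ, |s| ≤ |t| → |s + t| ^ q ≤ 2 ^ q * (|s| ^ q + |t| ^ q) := fun s t h => by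
    calc |s + t| ^ q ≤ (2 * |t|) ^ q :=
          Real.rpow_le_rpow (abs_nonneg _) ((abs_add_le s t).trans (by linarith)) hq
      _ = 2 ^ q * |t| ^ q := Real.mul_rpow (by norm_num) (abs_nonneg t)
      _ ≤ _ := by
          gcongr
          exact le_add_of_nonneg_left (by positivity)
  rcases le_total |u| |v| with h | h
  · exact key u v h
  · rw [add_comm u v, add_comm (|u| ^ q)]
    exact key v u h

/-- Jensen's inequality for `t ↦ |t| ^ q` and the weight `w`, proved with the tangent line. -/
theorem abs_average_sub_rpow_mul_le {E : Type*} [MeasurableSpace E] {μ : Measure E} (hq : 1 ≤ q)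
    {w φ : E → ℝ} (hw0 : ∀ x, 0 ≤ w x) (hw : Integrable w μ) (hW : 0 < ∫ x, w x ∂μ)
    (hφw : Integrable (fun x => φ x * w x) μ) (c : ℝ)
    (hI : Integrable (fun x => |φ x - c| ^ q * w x) μ) :
    |(∫ x, φ x * w x ∂μ) / (∫ x, w x ∂μ) - c| ^ q * ∫ x, w x ∂μ ≤
      ∫ x, |φ x - c| ^ q * w x ∂μ := by
  set W := ∫ x, w x ∂μ
  set t := |(∫ x, φ x * w x ∂μ) / W - c| with ht
  have hI0 : 0 ≤ ∫ x, |φ x - c| ^ q * w x ∂μ :=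
    integral_nonneg fun x => mul_nonneg (by positivity) (hw0 x)
  rcases (abs_nonneg ((∫ x, φ x * w x ∂μ) / W - c)).eq_or_lt with h0 | h0
  · rw [ht, ← h0, Real.zero_rpow (by linarith), zero_mul]
    exact hI0
  have ht0 : 0 < t := h0
  have i1 : Integrable (fun x => (φ x - c) * w x) μ := by
    simp only [sub_mul]
    exact hφw.sub (hw.const_mul c)
  have i2 : Integrable (fun x => |φ x - c| * w x) μ := by
    refine i1.norm.congr (Eventually.of_forall fun x => ?_)
    simp only [norm_mul, Real.norm_eq_abs, abs_of_nonneg (hw0 x)]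
  have i3 : Integrable (fun x => |φ x - c| * w x - t * w x) μ := i2.sub (hw.const_mul t)
  have htW : t * W ≤ ∫ x, |φ x - c| * w x ∂μ := by
    have e : ((∫ x, φ x * w x ∂μ) / W - c) * W = ∫ x, (φ x - c) * w x ∂μ := by
      simp only [sub_mul]
      rw [integral_sub hφw (hw.const_mul c), integral_const_mul, div_mul_cancel₀ _ hW.ne']
    calc t * W = |((∫ x, φ x * w x ∂μ) / W - c) * W| := by rw [abs_mul, abs_of_pos hW]
      _ ≤ ∫ x, |(φ x - c) * w x| ∂μ := by rw [e]; exact abs_integral_le_integral_abs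
      _ = _ := integral_congr_ae (Eventually.of_forall fun x => by
          simp only [abs_mul, abs_of_nonneg (hw0 x)])
  have htan : ∀ s : ℝ, 0 ≤ s → t ^ q + q * t ^ (q - 1) * (s - t) ≤ s ^ q := by
    intro s hs
    have h1 := one_add_mul_self_le_rpow_one_add (s := s / t - 1)
      (by linarith [div_nonneg hs ht0.le]) hq
    have h2 := mul_le_mul_of_nonneg_left h1 (by positivity : 0 ≤ t ^ q)
    rw [add_sub_cancel, Real.div_rpow hs ht0.le, mul_div_cancel₀ _ (by positivity)] at h2
    refine le_trans (le_of_eq ?_) h2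
    rw [Real.rpow_sub_one ht0.ne']
    field_simp
  have hmono : ∫ x, (t ^ q * w x + q * t ^ (q - 1) * (|φ x - c| * w x - t * w x)) ∂μ ≤
      ∫ x, |φ x - c| ^ q * w x ∂μ := by
    refine integral_mono ((hw.const_mul _).add (i3.const_mul _)) hI
      fun x => ?_
    have := mul_le_mul_of_nonneg_right (htan |φ x - c| (abs_nonneg _)) (hw0 x)
    simp only
    linarith
  rw [integral_add (hw.const_mul _) (i3.const_mul _), integral_const_mul,
    integral_const_mul, integral_sub i2 (hw.const_mul t), integral_const_mul] at hmono
  have : 0 ≤ q * t ^ (q - 1) * ((∫ x, |φ x - c| * w x ∂μ) - t * W) :=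
    mul_nonneg (by positivity) (by linarith)
  linarith

/-- The weighted Poincaré inequality for compactly supported `C¹` functions. -/
theorem exists_integral_sub_weightedAverage_le (hN : 2 ≤ N) (hq : 1 < q) (hα : α < 0)
    (hβ : 0 < β) (hγ : 0 < N + γ) (hαβγ : N + γ + α * β < 0) :
    ∃ A : ℝ, 0 < A ∧ ∀ φ : EuclideanSpace ℝ (Fin N) → ℝ,
      ContDiff ℝ 1 φ → HasCompactSupport φ →
      ∫ x, |φ x - weightedAverage (hpWeight N α β γ) φ| ^ q * hpWeight N α β γ x ≤
        A * gradEnergy q α β γ φ := by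
  have hN1 : 1 ≤ N := by lia
  obtain ⟨a, b, A, ha, hab, hA, H⟩ :=
    exists_integral_le_annulus_add_gradEnergy hN1 hq hα hβ hγ hαβγ
  obtain ⟨B, hB, H'⟩ := exists_annulus_integral_le_gradEnergy hN hq hα hγ hαβγ ha hab
  refine ⟨2 ^ q * (2 * (A * (B + 1))), by positivity, fun φ hφ hs => ?_⟩
  obtain ⟨c, hc⟩ := H' φ hφ hs
  obtain ⟨M, hM⟩ := hφ.continuous.bounded_above_of_compact_support hs
  set w := hpWeight N α β γ
  have iw : Integrable w := integrable_hpWeight hN1 hα hγ hαβγ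
  have iφ : Integrable fun x => φ x * w x :=
    iw.bdd_mul hφ.continuous.aestronglyMeasurable (Eventually.of_forall hM)
  have iu := integrable_abs_sub_rpow_mul hN1 hq hα hγ hαβγ hφ.continuous.aestronglyMeasurable
    (Eventually.of_forall hM)
  set m := weightedAverage w φ with hm
  have hJ : |m - c| ^ q * ∫ x, w x ≤ ∫ x, |φ x - c| ^ q * w x :=
    abs_average_sub_rpow_mul_le hq.le hpWeight_nonneg iw
      (integral_hpWeight_pos hN1 hα hγ hαβγ) iφ c (iu c)
  have hE : ∫ x, |φ x - c| ^ q * w x ≤ A * (B + 1) * gradEnergy q α β γ φ := by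
    refine (H φ hφ hs c).trans ?_
    rw [mul_assoc, add_mul, one_mul]
    gcongr
  calc ∫ x, |φ x - m| ^ q * w x
      ≤ ∫ x, 2 ^ q * (|φ x - c| ^ q * w x + |m - c| ^ q * w x) := by
        refine integral_mono (iu m) (((iu c).add (iw.const_mul _)).const_mul _) fun x => ?_
        have h1 := abs_add_rpow_le (q := q) (by linarith) (φ x - c) (-(m - c))
        rw [abs_neg, show φ x - c + -(m - c) = φ x - m by ring] at h1
        have := mul_le_mul_of_nonneg_right h1 (hpWeight_nonneg (α := α) (β := β) (γ := γ) x)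
        simp only [w]
        linarith
    _ = 2 ^ q * ((∫ x, |φ x - c| ^ q * w x) + |m - c| ^ q * ∫ x, w x) := by
        rw [integral_const_mul, integral_add (iu c) (iw.const_mul _), integral_const_mul]
    _ ≤ 2 ^ q * (A * (B + 1) * gradEnergy q α β γ φ + A * (B + 1) * gradEnergy q α β γ φ) := by
        exact mul_le_mul_of_nonneg_left (add_le_add hE (hJ.trans hE)) (by positivity)
    _ = _ := by ring

end Smooth

/-! ### Mollification -/

section Mollification

open ContinuousLinearMap

open scoped Convolution

variable {N : ℕ} {q α β γ : ℝ} {F : Type*} [NormedAddCommGroup F] [NormedSpace ℝ F]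

theorem norm_normed_convolution_le (ρ : ContDiffBump (0 : EuclideanSpace ℝ (Fin N)))
    {g : EuclideanSpace ℝ (Fin N) → F} {M : ℝ} (hM : ∀ᵐ x, ‖g x‖ ≤ M)
    (x : EuclideanSpace ℝ (Fin N)) :
    ‖(ρ.normed volume ⋆[lsmul ℝ ℝ, volume] g) x‖ ≤ M := by
  rw [convolution_lsmul_swap]
  have h1 : Integrable fun t => ρ.normed volume (x - t) := ρ.integrable_normed.comp_sub_left x
  calc ‖∫ t, ρ.normed volume (x - t) • g t‖ ≤ ∫ t, ρ.normed volume (x - t) * M := by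
        refine norm_integral_le_of_norm_le (h1.mul_const M) ?_
        filter_upwards [hM] with t ht
        rw [norm_smul, Real.norm_of_nonneg (ρ.nonneg_normed _)]
        exact mul_le_mul_of_nonneg_left ht (ρ.nonneg_normed _)
    _ = M := by
        rw [integral_mul_const, integral_sub_left_eq_self (ρ.normed volume) volume x,
          ρ.integral_normed, one_mul]

theorem normed_convolution_eq_zero (ρ : ContDiffBump (0 : EuclideanSpace ℝ (Fin N)))
    (hρ : ρ.rOut ≤ 1) {g : EuclideanSpace ℝ (Fin N) → F} {R : ℝ}
    (hg : ∀ᵐ x, R < ‖x‖ → g x = 0) {x : EuclideanSpace ℝ (Fin N)} (hx : R + 1 < ‖x‖) :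
    (ρ.normed volume ⋆[lsmul ℝ ℝ, volume] g) x = 0 := by
  rw [convolution_lsmul_swap]
  refine integral_eq_zero_of_ae ?_
  filter_upwards [hg] with t ht
  rcases lt_or_ge R ‖t‖ with h | h
  · simp [ht h]
  · have h1 : x - t ∉ Function.support (ρ.normed volume) := by
      rw [ρ.support_normed_eq, mem_ball_zero_iff, not_lt]
      linarith [norm_sub_norm_le x t]
    rw [Function.notMem_support.1 h1, zero_smul, Pi.zero_apply]

theorem contDiff_normed_convolution (ρ : ContDiffBump (0 : EuclideanSpace ℝ (Fin N)))
    {g : EuclideanSpace ℝ (Fin N) → ℝ} (hg : LocallyIntegrable g) :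
    ContDiff ℝ 1 (ρ.normed volume ⋆[lsmul ℝ ℝ, volume] g) :=
  ρ.hasCompactSupport_normed.contDiff_convolution_left _ (ρ.contDiff_normed (n := 1)) hg

/-- The gradient of a mollification is the mollification of the weak gradient. -/
theorem fderiv_normed_convolution (ρ : ContDiffBump (0 : EuclideanSpace ℝ (Fin N)))
    {φ : EuclideanSpace ℝ (Fin N) → ℝ} {G : EuclideanSpace ℝ (Fin N) → EuclideanSpace ℝ (Fin N)}
    (h : IsWeakGradient φ G) (x : EuclideanSpace ℝ (Fin N)) :
    fderiv ℝ (ρ.normed volume ⋆[lsmul ℝ ℝ, volume] φ) x =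
      innerSL ℝ ((ρ.normed volume ⋆[lsmul ℝ ℝ, volume] G) x) := by
  set r := ρ.normed volume with hr
  have hrs : HasCompactSupport r := ρ.hasCompactSupport_normed
  have hrc : ContDiff ℝ ∞ r := ρ.contDiff_normed (n := ⊤)
  have hr1 : ContDiff ℝ 1 r := ρ.contDiff_normed (n := 1)
  have hψs : HasCompactSupport fun t => r (x - t) :=
    hrs.comp_homeomorph (Homeomorph.subLeft x)
  have hψc : ContDiff ℝ ∞ fun t => r (x - t) := hrc.comp (contDiff_const.sub contDiff_id)
  have hψd : ∀ t v, fderiv ℝ (fun t => r (x - t)) t v = -fderiv ℝ r (x - t) v := by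
    intro t v
    have h1 : HasFDerivAt (fun t : EuclideanSpace ℝ (Fin N) => x - t)
        (-ContinuousLinearMap.id ℝ (EuclideanSpace ℝ (Fin N))) t := (hasFDerivAt_id t).const_sub x
    have h2 := ((hr1.differentiable one_ne_zero (x - t)).hasFDerivAt).comp t h1
    have h3 : fderiv ℝ (fun t => r (x - t)) t = _ := h2.fderiv
    rw [h3]
    simp
  have hD := (hrs.hasFDerivAt_convolution_left (lsmul ℝ ℝ) hr1 h.locallyIntegrable x).fderiv
  have key : ∀ i : Fin N, fderiv ℝ (r ⋆[lsmul ℝ ℝ, volume] φ) x (EuclideanSpace.single i 1) =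
      ((r ⋆[lsmul ℝ ℝ, volume] G) x) i := by
    intro i
    have hint : Integrable fun t => r (x - t) • G t := by
      have h1 := (hrs.convolutionExists_left (lsmul ℝ ℝ) hr1.continuous
        h.locallyIntegrable_grad x).integrable_swap
      simpa using h1
    have hint' := ((hrs.fderiv ℝ).convolutionExists_left ((lsmul ℝ ℝ).precompL
        (EuclideanSpace ℝ (Fin N))) (hr1.continuous_fderiv one_ne_zero)
        h.locallyIntegrable x).integrable_swap
    have e1 : ((r ⋆[lsmul ℝ ℝ, volume] G) x) i = ∫ t, G t i * r (x - t) := by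
      rw [convolution_lsmul_swap]
      refine ((EuclideanSpace.proj (𝕜 := ℝ) i).integral_comp_comm hint).symm.trans ?_
      exact integral_congr_ae (Eventually.of_forall fun t => mul_comm _ _)
    rw [hD, e1, convolution_eq_swap, ContinuousLinearMap.integral_apply hint',
      ← neg_eq_iff_eq_neg.2 (h.integral_eq _ hψc hψs i), ← integral_neg]
    refine integral_congr_ae (Eventually.of_forall fun t => ?_)
    simp only [hψd, precompL_apply, lsmul_apply, smul_eq_mul]
    ring
  refine ContinuousLinearMap.coe_injective
    ((EuclideanSpace.basisFun (Fin N) ℝ).toBasis.ext fun i => ?_)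
  simp [key, EuclideanSpace.inner_single_right]

end Mollification

/-! ### Passage to the limit -/

theorem exists_ae_norm_le_of_memLp_top {E F : Type*} [MeasurableSpace E] [NormedAddCommGroup F]
    {μ : Measure E} {f : E → F} (hf : MemLp f ∞ μ) : ∃ M : ℝ, 0 ≤ M ∧ ∀ᵐ x ∂μ, ‖f x‖ ≤ M := by
  refine ⟨(eLpNormEssSup f μ).toReal, ENNReal.toReal_nonneg, ?_⟩
  have hfin : eLpNormEssSup f μ ≠ ⊤ := by simpa using hf.eLpNorm_ne_top
  filter_upwards [ae_le_eLpNormEssSup (f := f) (μ := μ)] with x hx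
  rw [← toReal_enorm]
  exact ENNReal.toReal_mono hfin hx

/-- Radial bumps whose supports shrink to the origin, with the outer radius twice the inner one. -/
noncomputable def shrinkingBump (N n : ℕ) : ContDiffBump (0 : EuclideanSpace ℝ (Fin N)) where
  rIn := 1 / (2 * (n + 1))
  rOut := 1 / (n + 1)
  rIn_pos := by positivity
  rIn_lt_rOut := by
    apply one_div_lt_one_div_of_lt <;> linarith [(Nat.cast_nonneg n : (0 : ℝ) ≤ n)]

theorem mainTheorem7 (N : ℕ) (hN : 2 ≤ N) (q α β γ : ℝ) (hq : 1 < q)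
    (hq_two : N = 2 → q ≤ 2) (hq_three : 3 ≤ N → q < N)
    (hα : α < 0) (hβ : 0 < β) (hγ : 0 < N + γ) (hαβγ : N + γ + α * β < 0) :
    Integrable (hpWeight N α β γ) volume ∧
    0 < ∫ x, hpWeight N α β γ x ∧
    ∃ C : ℝ, 0 < C ∧
      ∀ (φ : EuclideanSpace ℝ (Fin N) → ℝ)
        (G : EuclideanSpace ℝ (Fin N) → EuclideanSpace ℝ (Fin N)),
        IsSobolevW1InftyWithGrad φ G → IsAECompactlySupported φ →
        Integrable (fun x => |φ x - weightedAverage (hpWeight N α β γ) φ| ^ q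
          * hpWeight N α β γ x) volume ∧
        Integrable (fun x => ‖G x‖ ^ q * (‖x‖ ^ (γ + q) * (1 + ‖x‖ ^ β) ^ α)) volume ∧
        ∫ x, |φ x - weightedAverage (hpWeight N α β γ) φ| ^ q * hpWeight N α β γ x
          ≤ C * ∫ x, ‖G x‖ ^ q * (‖x‖ ^ (γ + q) * (1 + ‖x‖ ^ β) ^ α) := by
  have hN1 : 1 ≤ N := by lia
  have hq0 : 0 < q := by linarith
  have iw := integrable_hpWeight hN1 hα hγ hαβγ
  refine ⟨iw, integral_hpWeight_pos hN1 hα hγ hαβγ, ?_⟩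
  obtain ⟨A, hA, H⟩ := exists_integral_sub_weightedAverage_le hN hq hα hβ hγ hαβγ
  refine ⟨A, hA, fun φ G hφG hcs => ?_⟩
  set w := hpWeight N α β γ with hw
  set m := weightedAverage w φ with hm
  have hφm := hφG.memLp.aestronglyMeasurable
  have hGm := hφG.memLp_grad.aestronglyMeasurable
  obtain ⟨M, hM0, hM⟩ := exists_ae_norm_le_of_memLp_top hφG.memLp
  obtain ⟨M', hM'0, hM'⟩ := exists_ae_norm_le_of_memLp_top hφG.memLp_grad
  obtain ⟨K, hK, hφK⟩ := hcs
  obtain ⟨R, hR0, hKR⟩ : ∃ R, 0 < R ∧ K ⊆ Metric.closedBall 0 R := by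
    obtain ⟨R, hR⟩ := hK.isBounded.subset_closedBall 0
    exact ⟨max R 1, by positivity, hR.trans (Metric.closedBall_subset_closedBall (le_max_left _ _))⟩
  have hφR : ∀ᵐ x, R < ‖x‖ → φ x = 0 := by
    filter_upwards [hφK] with x hx hxR
    exact hx fun hxK => absurd (mem_closedBall_zero_iff.1 (hKR hxK)) (not_le.2 hxR)
  -- The mollifications of `φ` and of its weak gradient.
  let b : ℕ → EuclideanSpace ℝ (Fin N) → ℝ := fun n => (shrinkingBump N n).normed volume
  set φ' : ℕ → EuclideanSpace ℝ (Fin N) → ℝ := fun n =>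
    convolution (b n) φ (ContinuousLinearMap.lsmul ℝ ℝ) volume with hφ'
  set G' : ℕ → EuclideanSpace ℝ (Fin N) → EuclideanSpace ℝ (Fin N) := fun n =>
    convolution (b n) G (ContinuousLinearMap.lsmul ℝ ℝ) volume with hG'
  have hout : Tendsto (fun n => (shrinkingBump N n).rOut) atTop (𝓝 0) :=
    tendsto_one_div_add_atTop_nhds_zero_nat
  have hrat : ∀ᶠ n in atTop, (shrinkingBump N n).rOut ≤ 2 * (shrinkingBump N n).rIn := by
    refine Eventually.of_forall fun n => le_of_eq ?_
    simp only [shrinkingBump]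
    field_simp
  have hle1 : ∀ n, (shrinkingBump N n).rOut ≤ 1 := fun n => by
    simp only [shrinkingBump]
    rw [div_le_one (by positivity)]
    linarith [(Nat.cast_nonneg n : (0 : ℝ) ≤ n)]
  have hweak := hφG.isWeakGradient
  have tφ : ∀ᵐ x, Tendsto (fun n => φ' n x) atTop (𝓝 (φ x)) :=
    ContDiffBump.ae_convolution_tendsto_right_of_locallyIntegrable hout hrat hweak.locallyIntegrable
  have tG : ∀ᵐ x, Tendsto (fun n => G' n x) atTop (𝓝 (G x)) :=
    ContDiffBump.ae_convolution_tendsto_right_of_locallyIntegrable hout hrat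
      hweak.locallyIntegrable_grad
  have hφ'c : ∀ n, ContDiff ℝ 1 (φ' n) := fun n =>
    contDiff_normed_convolution _ hweak.locallyIntegrable
  have hφ'0 : ∀ n x, R + 1 < ‖x‖ → φ' n x = 0 := fun n x hx =>
    normed_convolution_eq_zero _ (hle1 n) hφR hx
  have hφ's : ∀ n, HasCompactSupport (φ' n) := fun n =>
    HasCompactSupport.intro (isCompact_closedBall 0 (R + 1)) fun x hx =>
      hφ'0 n x (by simpa using hx)
  have hφ'M : ∀ n x, |φ' n x| ≤ M := fun n x => norm_normed_convolution_le _ hM x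
  have hG'M : ∀ n x, ‖G' n x‖ ≤ M' := fun n x => norm_normed_convolution_le _ hM' x
  have hfd : ∀ n x, ‖fderiv ℝ (φ' n) x‖ = ‖G' n x‖ := fun n x => by
    have h1 : fderiv ℝ (φ' n) x = innerSL ℝ (G' n x) :=
      fderiv_normed_convolution (shrinkingBump N n) hweak x
    rw [h1, innerSL_apply_norm]
  have hG'0 : ∀ n x, R + 1 < ‖x‖ → G' n x = 0 := fun n x hx => by
    have hev : φ' n =ᶠ[𝓝 x] fun _ => 0 := by
      filter_upwards [(isOpen_lt continuous_const continuous_norm).mem_nhds hx] with y hy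
      exact hφ'0 n y hy
    rw [← norm_eq_zero, ← hfd, hev.fderiv_eq]
    simp
  -- An integrable majorant of all the energy densities.
  have hdom : ∀ n, ∀ᵐ x, ‖‖G' n x‖ ^ q * hpWeight N α β (γ + q) x‖ ≤
      (M' * (R + 1)) ^ q * w x := fun n => by
    filter_upwards [energyWeight_ae_eq hN1 q α β γ] with x hx
    rw [Real.norm_of_nonneg (mul_nonneg (by positivity) (hpWeight_nonneg x)), hx, ← mul_assoc,
      ← Real.mul_rpow (norm_nonneg _) (norm_nonneg _)]
    refine mul_le_mul_of_nonneg_right ?_ (hpWeight_nonneg x)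
    refine Real.rpow_le_rpow (by positivity) ?_ hq0.le
    rcases le_or_gt ‖x‖ (R + 1) with h | h
    · exact mul_le_mul (hG'M n x) h (norm_nonneg _) hM'0
    · rw [hG'0 n x h, norm_zero, zero_mul]
      positivity
  have tGq : ∀ᵐ x, Tendsto (fun n => ‖G' n x‖ ^ q * hpWeight N α β (γ + q) x) atTop
      (𝓝 (‖G x‖ ^ q * hpWeight N α β (γ + q) x)) := by
    filter_upwards [tG] with x hx
    exact (hx.norm.rpow_const (Or.inr hq0.le)).mul_const _
  have iG : Integrable fun x => ‖G x‖ ^ q * hpWeight N α β (γ + q) x := by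
    refine (iw.const_mul ((M' * (R + 1)) ^ q)).mono'
      ((hGm.norm.aemeasurable.pow_const q).mul
        measurable_hpWeight.aemeasurable).aestronglyMeasurable ?_
    filter_upwards [tGq, ae_all_iff.2 hdom] with x hx hd
    exact le_of_tendsto hx.norm (Eventually.of_forall hd)
  have limE : Tendsto (fun n => gradEnergy q α β γ (φ' n)) atTop
      (𝓝 (∫ x, ‖G x‖ ^ q * hpWeight N α β (γ + q) x)) := by
    simp only [gradEnergy, hfd]
    refine tendsto_integral_of_dominated_convergence (fun x => (M' * (R + 1)) ^ q * w x)
      (fun n => ?_) (iw.const_mul _) hdom tGq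
    simp only [← hfd]
    exact (integrable_norm_fderiv_mul hN1 hq hα hγ hαβγ (hφ'c n) (hφ's n)).aestronglyMeasurable
  have limm : Tendsto (fun n => weightedAverage w (φ' n)) atTop (𝓝 m) := by
    refine Tendsto.div_const ?_ _
    refine tendsto_integral_of_dominated_convergence (fun x => M * w x)
      (fun n => (hφ'c n).continuous.aestronglyMeasurable.mul iw.aestronglyMeasurable)
      (iw.const_mul M) (fun n => Eventually.of_forall fun x => ?_) ?_
    · rw [norm_mul, Real.norm_of_nonneg (hpWeight_nonneg x)]
      exact mul_le_mul_of_nonneg_right (hφ'M n x) (hpWeight_nonneg x)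
    · filter_upwards [tφ] with x hx using hx.mul_const _
  have limL : Tendsto (fun n => ∫ x, |φ' n x - weightedAverage w (φ' n)| ^ q * w x) atTop
      (𝓝 (∫ x, |φ x - m| ^ q * w x)) := by
    refine tendsto_integral_filter_of_dominated_convergence
      (fun x => (M + (|m| + 1)) ^ q * w x) (Eventually.of_forall fun n => ?_) ?_
      (iw.const_mul _) ?_
    · exact (integrable_abs_sub_rpow_mul hN1 hq hα hγ hαβγ (hφ'c n).continuous.aestronglyMeasurable
        (Eventually.of_forall (hφ'M n)) _).aestronglyMeasurable
    · filter_upwards [limm.abs.eventually_le_const (lt_add_one |m|)] with n hn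
      refine Eventually.of_forall fun x => ?_
      rw [Real.norm_of_nonneg (mul_nonneg (by positivity) (hpWeight_nonneg x))]
      refine mul_le_mul_of_nonneg_right ?_ (hpWeight_nonneg x)
      exact Real.rpow_le_rpow (abs_nonneg _)
        ((abs_sub _ _).trans (add_le_add (hφ'M n x) hn)) hq0.le
    · filter_upwards [tφ] with x hx
      exact ((hx.sub limm).abs.rpow_const (Or.inr hq0.le)).mul_const _
  exact ⟨integrable_abs_sub_rpow_mul hN1 hq hα hγ hαβγ hφm hM m, iG,
    le_of_tendsto_of_tendsto' limL (limE.const_mul A) fun n => H (φ' n) (hφ'c n) (hφ's n)⟩
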